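/- Let $\omega=e^{2\pi i/3}$, $\Lambda=\omega\mathbb Z\oplus\mathbb Z\subset\mathbb C$, $\langle z,w\rangle=\operatorname{Re}(z\bar w)$, $K=\tfrac43\pi$, and let $\Lambda$-cell mean $\{s\omega+t:s,t\in[0,1)\}$. Let $U_\pm:\mathbb C\to\mathbb C$ be bounded measurable functions such that, for every $\gamma\in\Lambda$ and almost every $z$, $$U_\pm(z+\gamma)=e^{\pm i\langle\gamma,K\rangle}U_\pm(z),\qquad U_\pm(\omega z)=\omega U_\pm(z),$$ and put $V(z)=\begin{pmatrix}0&U_+(z)\\U_-(z)&0\end{pmatrix}$. (This includes the case $U_+(z)=U(z)$, $U_-(z)=U(-z)$.) Let $$L^2_0=\{u\in L^2_{\rm loc}(\mathbb C;\mathbb C^2):\ \operatorname{diag}(e^{i\langle\gamma,K\rangle},e^{-i\langle\gamma,K\rangle})\,u(z+\gamma)=u(z)\ \text{ for all }\gamma\in\Lambda\},$$ a Hilbert space with the $L^2$ inner product over the $\Lambda$-cell, and for $p\in\mathbb Z$ let $$L^2_{0,p}=\{u\in L^2_0:\ u(\omega z)=\bar\omega^{\,p}u(z)\},$$ which depends only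 on $p$ modulo $3$. Let $D_{\bar z}=\tfrac1i\partial_{\bar z}$, acting in the sense of distributions. Then $2D_{\bar z}$ on $L^2_0$ has a bounded inverse $R=(2D_{\bar z})^{-1}:L^2_0\to L^2_0$: for $u,f\in L^2_0$ one has $2D_{\bar z}u=f$ if and only if $u=Rf$. The bounded operator $RV:L^2_0\to L^2_0$ maps each $L^2_{0,p}$ into itself, and for every $p\in\mathbb Z$ $$\operatorname{Spec}_{L^2_{0,p}}(RV)=\operatorname{Spec}_{L^2_{0,-p+1}}(RV).$$ Moreover, for every integer $m\ge2$ the operators $(RV)^{2m}$ on $L^2_{0,p}$ and on $L^2_{0,-p+1}$ are of trace class and $$\operatorname{tr}_{L^2_{0,p}}(RV)^{2m}=\operatorname{tr}_{L^2_{0,-p+1}}(RV)^{2m}.$$ -/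

import Mathlib

noncomputable section

namespace ChiralTBG

open MeasureTheory Complex
open scoped ComplexConjugate ENNReal ContDiff

/-- The values of the wave functions: `ℂ²` with its Euclidean (Hermitian) norm. -/
abbrev E2 : Type := EuclideanSpace ℂ (Fin 2)

/-- `ω = exp(2πi/3)`. -/
def omega : ℂ := exp (2 * Real.pi * I / 3)

/-- The lattice `Λ = ωℤ ⊕ ℤ`. -/
def lattice : Set ℂ := {γ | ∃ a b : ℤ, γ = a * omega + b}

/-- The pairing `⟨z, w⟩ = Re (z \bar w)`. -/
def pairing (z w : ℂ) : ℝ := (z * conj w).re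

/-- The Dirac point `K = 4π/3`. -/
def diracK : ℂ := (4 / 3 * Real.pi : ℝ)

/-- The character `χ(γ) = exp(i⟨γ, K⟩)`. -/
def chi (γ : ℂ) : ℂ := exp (I * (pairing γ diracK : ℝ))

/-- The matrix `ρ(γ) = diag(χ(γ), χ(γ)⁻¹)` acting on `ℂ²`. -/
def rho (γ : ℂ) (v : E2) : E2 := !₂[chi γ * v 0, (chi γ)⁻¹ * v 1]

lemma rho_zero (γ : ℂ) : rho γ 0 = 0 := by
  ext i; fin_cases i <;> simp [rho]

lemma rho_add (γ : ℂ) (v w : E2) : rho γ (v + w) = rho γ v + rho γ w := by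
  ext i; fin_cases i <;> simp [rho, mul_add]

lemma rho_smul (γ c : ℂ) (v : E2) : rho γ (c • v) = c • rho γ v := by
  ext i; fin_cases i <;> simp [rho, mul_left_comm]

lemma omega_re : omega.re = -1 / 2 := by
  have h : (2 * Real.pi * I / 3 : ℂ) = ((Real.pi - Real.pi / 3 : ℝ) : ℂ) * I := by
    push_cast; ring
  rw [omega, h, exp_mul_I, ← ofReal_cos, ← ofReal_sin, Real.cos_pi_sub, Real.cos_pi_div_three]
  simp; norm_num

lemma omega_im : omega.im = √3 / 2 := by
  have h : (2 * Real.pi * I / 3 : ℂ) = ((Real.pi - Real.pi / 3 : ℝ) : ℂ) * I := by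
    push_cast; ring
  rw [omega, h, exp_mul_I, ← ofReal_cos, ← ofReal_sin, Real.sin_pi_sub, Real.sin_pi_div_three]
  simp

lemma norm_omega : ‖omega‖ = 1 := by
  have h : (2 * Real.pi * I / 3 : ℂ) = ((2 * Real.pi / 3 : ℝ) : ℂ) * I := by
    push_cast; ring
  rw [omega, h, norm_exp_ofReal_mul_I]

/-- `3K` lies in the dual lattice. -/
lemma chi_cube {γ : ℂ} (hγ : γ ∈ lattice) : chi γ ^ 3 = 1 := by
  obtain ⟨a, b, rfl⟩ := hγ
  rw [chi, ← exp_nat_mul, exp_eq_one_iff]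
  refine ⟨2 * b - a, ?_⟩
  have h : pairing (a * omega + b) diracK = (a * (-1 / 2) + b) * (4 / 3 * Real.pi) := by
    rw [pairing, diracK, conj_ofReal, re_mul_ofReal]
    simp [omega_re]
  rw [h]
  push_cast
  ring

lemma ae_translate {P : ℂ → Prop} (γ : ℂ) (h : ∀ᵐ z : ℂ, P z) : ∀ᵐ z : ℂ, P (z + γ) :=
  (measurePreserving_add_right volume γ).quasiMeasurePreserving.ae h

lemma ae_rotate {P : ℂ → Prop} (h : ∀ᵐ z : ℂ, P z) : ∀ᵐ z : ℂ, P (omega * z) := by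
  have hm := (rotation ⟨omega, by simp [Submonoid.unitSphere, norm_omega]⟩).measurePreserving
  exact hm.quasiMeasurePreserving.ae h

/-- The fundamental cell `{ sω + t : s, t ∈ [0, 1) }` of `Λ`. -/
def cell : Set ℂ := {z | ∃ s t : ℝ, s ∈ Set.Ico (0 : ℝ) 1 ∧ t ∈ Set.Ico (0 : ℝ) 1 ∧ z = s * omega + t}

/-- `L²_loc(ℂ; ℂ²)`-classes `u` with `ρ(γ) u(z + γ) = u(z)` for all `γ ∈ Λ`: the space `L²_0`. -/
def L2zeroSub : Submodule ℂ (ℂ →ₘ[volume] E2) where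
  carrier := {u | (∀ S : Set ℂ, IsCompact S → MemLp u 2 (volume.restrict S)) ∧
    ∀ γ ∈ lattice, ∀ᵐ z : ℂ, rho γ (u (z + γ)) = u z}
  zero_mem' := by
    have h0 : ((0 : ℂ →ₘ[volume] E2) : ℂ → E2) =ᵐ[volume] 0 := AEEqFun.coeFn_zero
    refine ⟨fun S _ => ?_, fun γ _ => ?_⟩
    · exact (memLp_congr_ae (ae_restrict_of_ae h0)).2 MemLp.zero'
    · filter_upwards [h0, ae_translate γ h0] with z hz hz'
      simp only [Pi.zero_apply] at hz hz'
      rw [hz, hz', rho_zero]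
  add_mem' := by
    intro u v hu hv
    have h0 := AEEqFun.coeFn_add u v
    refine ⟨fun S hS => ?_, fun γ hγ => ?_⟩
    · exact (memLp_congr_ae (ae_restrict_of_ae h0)).2 ((hu.1 S hS).add (hv.1 S hS))
    · filter_upwards [h0, ae_translate γ h0, hu.2 γ hγ, hv.2 γ hγ] with z hz hz' h1 h2
      rw [hz, hz', Pi.add_apply, Pi.add_apply, rho_add, h1, h2]
  smul_mem' := by
    intro c u hu
    have h0 := AEEqFun.coeFn_smul c u
    refine ⟨fun S hS => ?_, fun γ hγ => ?_⟩
    · exact (memLp_congr_ae (ae_restrict_of_ae h0)).2 ((hu.1 S hS).const_smul c)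
    · filter_upwards [h0, ae_translate γ h0, hu.2 γ hγ] with z hz hz' h1
      rw [hz, hz', Pi.smul_apply, Pi.smul_apply, rho_smul, h1]

/-- The space `L²_0` as a type. -/
abbrev L2zero : Type := L2zeroSub

lemma memLp_cell (u : L2zero) : MemLp (u : ℂ →ₘ[volume] E2) 2 (volume.restrict cell) := by
  refine (u.2.1 (Metric.closedBall 0 2) (isCompact_closedBall _ _)).mono_measure
    (Measure.restrict_mono ?_ le_rfl)
  rintro z ⟨s, t, hs, ht, rfl⟩
  rw [mem_closedBall_zero_iff]
  calc ‖(s * omega + t : ℂ)‖ ≤ ‖(s * omega : ℂ)‖ + ‖(t : ℂ)‖ := norm_add_le _ _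
    _ = |s| + |t| := by rw [norm_mul, norm_omega, norm_real, norm_real]; simp
    _ ≤ 2 := by rw [abs_of_nonneg hs.1, abs_of_nonneg ht.1]; linarith [hs.2, ht.2]

/-- Restriction of an element of `L²_0` to the fundamental cell. -/
def toCell : L2zero →ₗ[ℂ] Lp E2 2 (volume.restrict cell) where
  toFun u := (memLp_cell u).toLp _
  map_add' u v := by
    rw [← MemLp.toLp_add]
    exact MemLp.toLp_congr _ _ (ae_restrict_of_ae (AEEqFun.coeFn_add _ _))
  map_smul' c u := by
    rw [RingHom.id_apply, ← MemLp.toLp_const_smul]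
    exact MemLp.toLp_congr _ _ (ae_restrict_of_ae (AEEqFun.coeFn_smul _ _))

lemma cell_eq : cell = {z : ℂ | z.im / omega.im ∈ Set.Ico (0 : ℝ) 1 ∧
    z.re - z.im / omega.im * omega.re ∈ Set.Ico (0 : ℝ) 1} := by
  have ho : omega.im ≠ 0 := by rw [omega_im]; positivity
  ext z
  constructor
  · rintro ⟨s, t, hs, ht, rfl⟩
    have h1 : (s * omega + t : ℂ).im / omega.im = s := by simp [ho]
    have h2 : (s * omega + t : ℂ).re - s * omega.re = t := by simp
    simp only [Set.mem_ofPred_eq, h1, h2]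
    exact ⟨hs, ht⟩
  · rintro ⟨h1, h2⟩
    refine ⟨_, _, h1, h2, ?_⟩
    apply Complex.ext <;> simp [ho]

lemma measurableSet_cell : MeasurableSet cell := by
  rw [cell_eq]
  refine MeasurableSet.inter ?_ ?_ <;> refine measurableSet_Ico.preimage ?_ <;> fun_prop

lemma exists_translate_mem_cell (z : ℂ) : ∃ a b : ℤ, z + (a * omega + b) ∈ cell := by
  have ho : omega.im ≠ 0 := by rw [omega_im]; positivity
  refine ⟨-⌊z.im / omega.im⌋, -⌊z.re - z.im / omega.im * omega.re⌋, Int.fract (z.im / omega.im),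
    Int.fract (z.re - z.im / omega.im * omega.re), ⟨Int.fract_nonneg _, Int.fract_lt_one _⟩,
    ⟨Int.fract_nonneg _, Int.fract_lt_one _⟩, ?_⟩
  have h1 : z.im = (Int.fract (z.im / omega.im) + ⌊z.im / omega.im⌋) * omega.im := by
    rw [Int.fract_add_floor]; field_simp
  have h2 := Int.fract_add_floor (z.re - z.im / omega.im * omega.re)
  have h3 := Int.fract_add_floor (z.im / omega.im)
  apply Complex.ext
  · simp only [add_re, mul_re, intCast_re, intCast_im, ofReal_re, ofReal_im, Int.cast_neg, neg_re,
      neg_im, zero_mul, neg_zero, sub_zero]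
    linear_combination -h2 - omega.re * h3
  · simp only [add_im, mul_im, intCast_re, intCast_im, ofReal_re, ofReal_im, Int.cast_neg, neg_re,
      neg_im, zero_mul, neg_zero, add_zero]
    linear_combination h1

lemma toCell_injective : Function.Injective toCell := by
  intro u v huv
  have h0 : ∀ᵐ z : ℂ, z ∈ cell → (u : ℂ →ₘ[volume] E2) z = (v : ℂ →ₘ[volume] E2) z := by
    rw [← ae_restrict_iff' measurableSet_cell]
    exact (MemLp.toLp_eq_toLp_iff (memLp_cell u) (memLp_cell v)).1 huv
  have h1 : ∀ᵐ z : ℂ, ∀ a b : ℤ, z + (a * omega + b) ∈ cell →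
      (u : ℂ →ₘ[volume] E2) (z + (a * omega + b)) = (v : ℂ →ₘ[volume] E2) (z + (a * omega + b)) :=
    ae_all_iff.2 fun a => ae_all_iff.2 fun b => ae_translate _ h0
  have h2 (w : L2zero) : ∀ᵐ z : ℂ, ∀ a b : ℤ, rho (a * omega + b) ((w : ℂ →ₘ[volume] E2)
      (z + (a * omega + b))) = (w : ℂ →ₘ[volume] E2) z :=
    ae_all_iff.2 fun a => ae_all_iff.2 fun b => w.2.2 _ ⟨a, b, rfl⟩
  refine Subtype.ext (AEEqFun.ext ?_)
  filter_upwards [h1, h2 u, h2 v] with z h1 hu hv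
  obtain ⟨a, b, hab⟩ := exists_translate_mem_cell z
  rw [← hu a b, ← hv a b, h1 a b hab]

instance : NormedAddCommGroup L2zero := NormedAddCommGroup.induced _ _ toCell toCell_injective

/-- The inner product of `L²_0` is `⟪u, v⟫ = ∫_cell ⟪u(z), v(z)⟫ dz`. -/
instance : InnerProductSpace ℂ L2zero := InnerProductSpace.induced toCell

lemma inner_eq (u v : L2zero) : inner ℂ u v =
    ∫ z in cell, inner ℂ ((u : ℂ →ₘ[volume] E2) z) ((v : ℂ →ₘ[volume] E2) z) := by
  change inner ℂ (toCell u) (toCell v) = _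
  rw [L2.inner_def]
  refine integral_congr_ae ?_
  filter_upwards [(memLp_cell u).coeFn_toLp, (memLp_cell v).coeFn_toLp] with z h1 h2
  exact congrArg₂ _ h1 h2

/-- The closed subspace `L²_{0,p}` of `L²_0`: `u(ωz) = \bar ω^p u(z)`. -/
def L2rot (p : ℤ) : Submodule ℂ L2zero where
  carrier := {u | ∀ᵐ z : ℂ, (u : ℂ →ₘ[volume] E2) (omega * z) =
    (conj omega) ^ p • (u : ℂ →ₘ[volume] E2) z}
  zero_mem' := by
    have h0 : ((0 : ℂ →ₘ[volume] E2) : ℂ → E2) =ᵐ[volume] 0 := AEEqFun.coeFn_zero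
    change ∀ᵐ z : ℂ, (0 : ℂ →ₘ[volume] E2) (omega * z) = _ • (0 : ℂ →ₘ[volume] E2) z
    filter_upwards [h0, ae_rotate h0] with z hz hz'
    simp only [Pi.zero_apply] at hz hz'
    rw [hz, hz', smul_zero]
  add_mem' := by
    intro u v hu hv
    have h0 := AEEqFun.coeFn_add (u : ℂ →ₘ[volume] E2) (v : ℂ →ₘ[volume] E2)
    rw [Set.mem_ofPred_eq] at hu hv ⊢
    rw [Submodule.coe_add]
    filter_upwards [h0, ae_rotate h0, hu, hv] with z hz hz' h1 h2
    rw [hz, hz', Pi.add_apply, Pi.add_apply, h1, h2, smul_add]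
  smul_mem' := by
    intro c u hu
    have h0 := AEEqFun.coeFn_smul c (u : ℂ →ₘ[volume] E2)
    rw [Set.mem_ofPred_eq] at hu ⊢
    rw [Submodule.coe_smul]
    filter_upwards [h0, ae_rotate h0, hu] with z hz hz' h1
    rw [hz, hz', Pi.smul_apply, Pi.smul_apply, h1, smul_comm]

/-- Bounded measurable potentials `U_±` with `U_±(z + γ) = exp(±i⟨γ, K⟩) U_±(z)` for `γ ∈ Λ` and
`U_±(ωz) = ω U_±(z)`. The relation `U_-(z) = U_+(-z)` is a special case and is not required. -/
structure IsPotential (Up Um : ℂ → ℂ) : Prop where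
  measurable_plus : AEStronglyMeasurable Up volume
  measurable_minus : AEStronglyMeasurable Um volume
  bounded : ∃ C : ℝ, ∀ᵐ z : ℂ, ‖Up z‖ ≤ C ∧ ‖Um z‖ ≤ C
  translation_plus : ∀ γ ∈ lattice, ∀ᵐ z : ℂ, Up (z + γ) = chi γ * Up z
  translation_minus : ∀ γ ∈ lattice, ∀ᵐ z : ℂ, Um (z + γ) = (chi γ)⁻¹ * Um z
  rotation_plus : ∀ᵐ z : ℂ, Up (omega * z) = omega * Up z
  rotation_minus : ∀ᵐ z : ℂ, Um (omega * z) = omega * Um z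

/-- The matrix `V(z)` with zero diagonal and off-diagonal entries `U_+(z)`, `U_-(z)`, applied to a
vector. -/
def Vmat (Up Um : ℂ → ℂ) (z : ℂ) (v : E2) : E2 := !₂[Up z * v 1, Um z * v 0]

variable {Up Um : ℂ → ℂ}

lemma Vmat_add (z : ℂ) (v w : E2) : Vmat Up Um z (v + w) = Vmat Up Um z v + Vmat Up Um z w := by
  ext i; fin_cases i <;> simp [Vmat, mul_add]

lemma Vmat_smul (z c : ℂ) (v : E2) : Vmat Up Um z (c • v) = c • Vmat Up Um z v := by
  ext i; fin_cases i <;> simp [Vmat, mul_left_comm]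

lemma norm_Vmat_le {C : ℝ} {z : ℂ} (h : ‖Up z‖ ≤ C ∧ ‖Um z‖ ≤ C) (v : E2) :
    ‖Vmat Up Um z v‖ ≤ C * ‖v‖ := by
  have hC : 0 ≤ C := (norm_nonneg _).trans h.1
  rw [EuclideanSpace.norm_eq, EuclideanSpace.norm_eq]
  refine Real.sqrt_le_iff.2 ⟨by positivity, ?_⟩
  rw [mul_pow, Real.sq_sqrt (by positivity)]
  simp only [Vmat, Fin.sum_univ_two, Matrix.cons_val_zero, Matrix.cons_val_one, norm_mul,
    mul_pow]
  have h1 : ‖Up z‖ ^ 2 ≤ C ^ 2 := by gcongr; exact h.1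
  have h2 : ‖Um z‖ ^ 2 ≤ C ^ 2 := by gcongr; exact h.2
  nlinarith [mul_le_mul_of_nonneg_right h1 (sq_nonneg ‖v 1‖),
    mul_le_mul_of_nonneg_right h2 (sq_nonneg ‖v 0‖)]

/-- The function `z ↦ V(z) u(z)`. -/
def mulVfun (hU : IsPotential Up Um) (u : L2zero) : ℂ →ₘ[volume] E2 :=
  AEEqFun.mk (fun z => Vmat Up Um z ((u : ℂ →ₘ[volume] E2) z)) (by
    have hu := (u : ℂ →ₘ[volume] E2).aestronglyMeasurable
    have h0 : AEStronglyMeasurable (fun z => ((u : ℂ →ₘ[volume] E2) z) 0) volume :=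
      (EuclideanSpace.proj (𝕜 := ℂ) (0 : Fin 2)).continuous.comp_aestronglyMeasurable hu
    have h1 : AEStronglyMeasurable (fun z => ((u : ℂ →ₘ[volume] E2) z) 1) volume :=
      (EuclideanSpace.proj (𝕜 := ℂ) (1 : Fin 2)).continuous.comp_aestronglyMeasurable hu
    have hc : Continuous fun q : ℂ × ℂ => (!₂[q.1, q.2] : E2) := by fun_prop
    exact hc.comp_aestronglyMeasurable
      ((hU.measurable_plus.mul h1).prodMk (hU.measurable_minus.mul h0)))

lemma mulVfun_ae (hU : IsPotential Up Um) (u : L2zero) :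
    ∀ᵐ z : ℂ, mulVfun hU u z = Vmat Up Um z ((u : ℂ →ₘ[volume] E2) z) :=
  AEEqFun.coeFn_mk _ _

lemma mulVfun_mem (hU : IsPotential Up Um) (u : L2zero) : mulVfun hU u ∈ L2zeroSub := by
  obtain ⟨C, hC⟩ := hU.bounded
  have h0 := mulVfun_ae hU u
  refine ⟨fun S hS => ?_, fun γ hγ => ?_⟩
  · refine (u.2.1 S hS).of_le_mul (c := C) (mulVfun hU u).aestronglyMeasurable.restrict
      (ae_restrict_of_ae ?_)
    filter_upwards [h0, hC] with z hz hz'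
    rw [hz]
    exact norm_Vmat_le hz' _
  · filter_upwards [h0, ae_translate γ h0, u.2.2 γ hγ, hU.translation_plus γ hγ,
      hU.translation_minus γ hγ] with z hz hz' h1 h2 h3
    rw [hz, hz', ← h1]
    have hc : chi γ ≠ 0 := exp_ne_zero _
    have hc3 := chi_cube hγ
    ext i
    fin_cases i
    · simp only [rho, Vmat, Fin.zero_eta, Matrix.cons_val_zero, Matrix.cons_val_one, h2]
      field_simp
      linear_combination (Up z * ((u : ℂ →ₘ[volume] E2) (z + γ)) 1) * hc3
    · simp only [rho, Vmat, Fin.mk_one, Matrix.cons_val_zero, Matrix.cons_val_one, h3]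
      field_simp
      linear_combination -(Um z * ((u : ℂ →ₘ[volume] E2) (z + γ)) 0) * hc3

/-- Multiplication by `V` as a linear map of `L²_0`. -/
def mulVlin (hU : IsPotential Up Um) : L2zero →ₗ[ℂ] L2zero where
  toFun u := ⟨mulVfun hU u, mulVfun_mem hU u⟩
  map_add' u v := by
    apply Subtype.ext
    refine AEEqFun.ext ?_
    rw [Submodule.coe_add]
    filter_upwards [mulVfun_ae hU (u + v), AEEqFun.coeFn_add (mulVfun hU u) (mulVfun hU v),
      mulVfun_ae hU u, mulVfun_ae hU v,
      AEEqFun.coeFn_add (u : ℂ →ₘ[volume] E2) (v : ℂ →ₘ[volume] E2)] with z h1 h2 h3 h4 h5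
    rw [h1, h2, Pi.add_apply, h3, h4, Submodule.coe_add, h5, Pi.add_apply, Vmat_add]
  map_smul' c u := by
    apply Subtype.ext
    refine AEEqFun.ext ?_
    rw [Submodule.coe_smul]
    filter_upwards [mulVfun_ae hU (c • u), AEEqFun.coeFn_smul c (mulVfun hU u),
      mulVfun_ae hU u, AEEqFun.coeFn_smul c (u : ℂ →ₘ[volume] E2)] with z h1 h2 h3 h5
    rw [h1]
    simp only [RingHom.id_apply]
    rw [h2, Pi.smul_apply, h3, Submodule.coe_smul, h5, Pi.smul_apply, Vmat_smul]

lemma mulVlin_bound (hU : IsPotential Up Um) : ∃ C : ℝ, ∀ u, ‖mulVlin hU u‖ ≤ C * ‖u‖ := by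
  obtain ⟨C, hC⟩ := hU.bounded
  refine ⟨C, fun u => ?_⟩
  change ‖toCell (mulVlin hU u)‖ ≤ C * ‖toCell u‖
  refine Lp.norm_le_mul_norm_of_ae_le_mul ?_
  filter_upwards [(memLp_cell (mulVlin hU u)).coeFn_toLp, (memLp_cell u).coeFn_toLp,
    ae_restrict_of_ae hC, ae_restrict_of_ae (mulVfun_ae hU u)] with z h1 h2 h3 h4
  change ‖(memLp_cell (mulVlin hU u)).toLp _ z‖ ≤ C * ‖(memLp_cell u).toLp _ z‖
  rw [h1, h2]
  change ‖mulVfun hU u z‖ ≤ _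
  rw [h4]
  exact norm_Vmat_le h3 _

/-- The multiplication operator `V : L²_0 → L²_0`. -/
def mulV (hU : IsPotential Up Um) : L2zero →L[ℂ] L2zero :=
  (mulVlin hU).mkContinuousOfExistsBound (mulVlin_bound hU)

/-- `2 D_{\bar z} φ = -i (∂_x + i ∂_y) φ` for a (real-)differentiable `φ : ℂ → ℂ`. -/
def twoDbar (φ : ℂ → ℂ) (z : ℂ) : ℂ := -I * (fderiv ℝ φ z 1 + I * fderiv ℝ φ z I)

/-- `2 D_{\bar z} u = f` in the sense of distributions on `ℂ`. -/
def WeakDbarEq (u f : L2zero) : Prop :=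
  ∀ φ : ℂ → ℂ, ContDiff ℝ ∞ φ → HasCompactSupport φ →
    ∫ z, twoDbar φ z • (u : ℂ →ₘ[volume] E2) z = -∫ z, φ z • (f : ℂ →ₘ[volume] E2) z

/-- `R = (2 D_{\bar z})⁻¹` on `L²_0`: the bounded operator for which `u = R f` is the one and only
solution in `L²_0` of `2 D_{\bar z} u = f`. -/
def IsDbarInverse (R : L2zero →L[ℂ] L2zero) : Prop :=
  ∀ u f : L2zero, WeakDbarEq u f ↔ u = R f

section Trace

variable {H : Type} [NormedAddCommGroup H] [InnerProductSpace ℂ H]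

/-- Trace class (= nuclear) operators on a Hilbert space. -/
def IsTraceClass (T : H →L[ℂ] H) : Prop :=
  ∃ (ι : Type) (a b : ι → H), Summable (fun n => ‖a n‖ * ‖b n‖) ∧
    ∀ x, HasSum (fun n => inner ℂ (a n) x • b n) (T x)

/-- `T` is of trace class and its trace, computed in any orthonormal basis, is `τ`. -/
def HasTrace (T : H →L[ℂ] H) (τ : ℂ) : Prop :=
  IsTraceClass T ∧ ∀ (ι : Type) (e : HilbertBasis ι ℂ H), HasSum (fun i => inner ℂ (e i) (T (e i))) τ

end Trace

end ChiralTBG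

end

/-!
The operator `2 D_{\bar z}` is diagonal in the Fourier basis of `L²_0` (`modeBasis`). The frequencies
in the two components are the points of the dual lattice shifted by `-K` and by `K`; since `K` is not
in the dual lattice, the eigenvalues stay away from `0`, and their inverses lie in `ℓ⁴`
(`summable_resolventEigenvalue`). The diagonal operator `R` with these inverse eigenvalues solves the
equation, and testing against the functions of `exists_test_function` shows that a distributional
solution has no other Fourier coefficients (`isDbarInverse_dbarInverse`).

Let `P p` be the orthogonal projection onto `L²_{0,p}`, the average of the powers of the rotation
`u ↦ u(ω ·)`. Then `V` maps `L²_{0,p}` to `L²_{0,p-1}` and `R` maps `L²_{0,p}` to `L²_{0,p+1}`. The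
symmetry `p ↦ 1 - p` comes from the symplectic bilinear form `∫ (u₀ v₁ - u₁ v₀)` on `L²_0`, which is
`⟪J u, v⟫` for an antiunitary `J` (`quat`). For the transpose `T ↦ J⁻¹ T* J` of this form,
`Vᵗ = -V` because `V(z)` has trace zero (`transpose_mulV`), `Rᵗ = -R` by integration by parts
(`transpose_dbarInverse`), and `(P p)ᵗ = P (-p)` (`transpose_rotProj`). Hence
`(R V P p)ᵗ = P (-p) V R`, and moving `R` to the front gives `R P (-p) V = R V P (1 - p)`.
Transposition preserves spectra and traces, and cyclic permutation preserves traces and nonzero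
spectra; the point `0` lies in every spectrum because the eigenvalues of `R` tend to `0`
(`zero_mem_spectrum_restrict`). This argument is `spectrum_and_trace_symmetry`.

For the trace class property, `R V R` is Hilbert-Schmidt although `R` is not
(`isHilbertSchmidt_sandwich`), so `R (V R)³ = (R V R) V (R V R)` is of trace class; this is the factor
to which cyclicity of the trace is applied.
-/

noncomputable section

namespace ChiralTBG

open MeasureTheory Complex
open scoped ComplexConjugate ENNReal ContDiff

/-! ### Trace class and Hilbert-Schmidt operators -/

section Operators

open ContinuousLinearMap

variable {H : Type} [NormedAddCommGroup H] [InnerProductSpace ℂ H]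

/-- `T = ∑ₙ ⟪aₙ, ·⟫ bₙ` for some nuclear expansion with `∑ₙ ⟪aₙ, bₙ⟫ = τ`. By
`HasNuclearTrace.hasSum_diag` the number `τ` does not depend on the expansion. -/
def HasNuclearTrace (T : H →L[ℂ] H) (τ : ℂ) : Prop :=
  ∃ (ι : Type) (a b : ι → H), Summable (fun n => ‖a n‖ * ‖b n‖) ∧
    (∀ x, HasSum (fun n => inner ℂ (a n) x • b n) (T x)) ∧
    HasSum (fun n => inner ℂ (a n) (b n)) τ

/-- The trace of a nuclear expansion is the sum of the diagonal entries in any Hilbert basis: the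
double series `∑ ⟪aₙ, eᵢ⟫ ⟪eᵢ, bₙ⟫` converges absolutely, by the Cauchy-Schwarz and Bessel
inequalities. -/
lemma HasNuclearTrace.hasSum_diag {T : H →L[ℂ] H} {τ : ℂ} (hT : HasNuclearTrace T τ) {κ : Type*}
    (e : HilbertBasis κ ℂ H) : HasSum (fun i => inner ℂ (e i) (T (e i))) τ := by
  obtain ⟨ι, a, b, hab, hs, hτ⟩ := hT
  set F : ι × κ → ℂ := fun q => inner ℂ (a q.1) (e q.2) * inner ℂ (e q.2) (b q.1) with hF
  have hfin (n : ι) (s : Finset κ) : ∑ i ∈ s, ‖F (n, i)‖ ≤ ‖a n‖ * ‖b n‖ := by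
    calc ∑ i ∈ s, ‖F (n, i)‖ = ∑ i ∈ s, ‖inner ℂ (e i) (a n)‖ * ‖inner ℂ (e i) (b n)‖ := by
          refine Finset.sum_congr rfl fun i _ => ?_
          rw [hF, norm_mul, norm_inner_symm]
      _ ≤ √(∑ i ∈ s, ‖inner ℂ (e i) (a n)‖ ^ 2) * √(∑ i ∈ s, ‖inner ℂ (e i) (b n)‖ ^ 2) :=
          Real.sum_mul_le_sqrt_mul_sqrt _ _ _
      _ ≤ √(‖a n‖ ^ 2) * √(‖b n‖ ^ 2) := by
          gcongr <;> exact e.orthonormal.sum_inner_products_le _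
      _ = ‖a n‖ * ‖b n‖ := by
          rw [Real.sqrt_sq (norm_nonneg _), Real.sqrt_sq (norm_nonneg _)]
  have hsum : Summable F := by
    refine Summable.of_norm ((summable_prod_of_nonneg fun q => norm_nonneg _).2 ⟨fun n => ?_, ?_⟩)
    · exact summable_of_sum_le (fun i => norm_nonneg _) (hfin n)
    · exact hab.of_nonneg_of_le (fun n => tsum_nonneg fun i => norm_nonneg _)
        fun n => Real.tsum_le_of_sum_le (fun i => norm_nonneg _) (hfin n)
  have h1 : HasSum (fun n => inner ℂ (a n) (b n)) (∑' q, F q) :=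
    hsum.hasSum.prod_fiberwise fun n => e.hasSum_inner_mul_inner (a n) (b n)
  rw [hτ.unique h1]
  have h2 : HasSum (fun q : κ × ι => F (q.2, q.1)) (∑' q, F q) :=
    (Equiv.prodComm κ ι).hasSum_iff.2 hsum.hasSum
  refine h2.prod_fiberwise fun i => ?_
  have := (hs (e i)).mapL (innerSL ℂ (e i))
  simpa [hF, inner_smul_right] using this

lemma HasNuclearTrace.hasTrace {T : H →L[ℂ] H} {τ : ℂ} (hT : HasNuclearTrace T τ) :
    HasTrace T τ := by
  refine ⟨?_, fun κ e => hT.hasSum_diag e⟩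
  obtain ⟨ι, a, b, hab, hs, -⟩ := hT
  exact ⟨ι, a, b, hab, hs⟩

lemma hasSum_norm_inner_sq {κ : Type*} (e : HilbertBasis κ ℂ H) (x : H) :
    HasSum (fun i => ‖inner ℂ (e i) x‖ ^ 2) (‖x‖ ^ 2) := by
  have h := (e.hasSum_inner_mul_inner x x).mapL reCLM
  simp only [reCLM_apply] at h
  rw [show (inner ℂ x x).re = ‖x‖ ^ 2 from inner_self_eq_norm_sq (𝕜 := ℂ) x] at h
  convert h using 2 with i
  rw [← inner_conj_symm x (e i), mul_comm, mul_conj, ofReal_re, normSq_eq_norm_sq]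

/-- The Hilbert-Schmidt condition `∑ᵢ ‖A eᵢ‖² < ∞`, stated in one fixed Hilbert basis `e`. -/
def IsHilbertSchmidt {κ : Type} (e : HilbertBasis κ ℂ H) (A : H →L[ℂ] H) : Prop :=
  Summable fun i => ‖A (e i)‖ ^ 2

lemma IsHilbertSchmidt.mul_left {κ : Type} {e : HilbertBasis κ ℂ H} {A : H →L[ℂ] H}
    (h : IsHilbertSchmidt e A) (B : H →L[ℂ] H) : IsHilbertSchmidt e (B * A) := by
  refine (Summable.mul_left (‖B‖ ^ 2) h).of_nonneg_of_le (fun i => by positivity) fun i => ?_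
  rw [← mul_pow]
  gcongr
  exact B.le_opNorm _

variable [CompleteSpace H]

lemma HasNuclearTrace.unique {T : H →L[ℂ] H} {τ τ' : ℂ} (h : HasNuclearTrace T τ)
    (h' : HasNuclearTrace T τ') : τ = τ' := by
  obtain ⟨w, e, -⟩ := exists_hilbertBasis ℂ H
  exact (h.hasSum_diag e).unique (h'.hasSum_diag e)

/-- Cyclicity of the trace: both products have nuclear expansions obtained from the one of `A`, with
the same diagonal sum. -/
lemma IsTraceClass.exists_trace_mul_comm {A : H →L[ℂ] H} (hA : IsTraceClass A) (B : H →L[ℂ] H) :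
    ∃ τ, HasNuclearTrace (A * B) τ ∧ HasNuclearTrace (B * A) τ := by
  obtain ⟨ι, a, b, hab, hs⟩ := hA
  have h1 : Summable fun n => ‖a n‖ * ‖B (b n)‖ := by
    refine (hab.mul_left ‖B‖).of_nonneg_of_le (fun n => by positivity) fun n => ?_
    rw [mul_left_comm]
    gcongr
    exact B.le_opNorm _
  have h2 : Summable fun n => ‖(adjoint B) (a n)‖ * ‖b n‖ := by
    refine (hab.mul_left ‖adjoint B‖).of_nonneg_of_le (fun n => by positivity) fun n => ?_
    rw [← mul_assoc]
    gcongr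
    exact ContinuousLinearMap.le_opNorm _ _
  have h3 : Summable fun n => inner ℂ (a n) (B (b n)) :=
    Summable.of_norm_bounded h1 fun n => norm_inner_le_norm _ _
  refine ⟨_, ⟨ι, fun n => (adjoint B) (a n), b, h2, fun x => ?_, ?_⟩,
    ⟨ι, a, fun n => B (b n), h1, fun x => ?_, h3.hasSum⟩⟩
  · simp only [adjoint_inner_left]
    exact hs (B x)
  · simpa only [adjoint_inner_left] using h3.hasSum
  · simpa using (hs x).mapL B

lemma IsTraceClass.mul_right {A : H →L[ℂ] H} (hA : IsTraceClass A) (B : H →L[ℂ] H) :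
    IsTraceClass (A * B) := by
  obtain ⟨τ, h, -⟩ := hA.exists_trace_mul_comm B
  exact h.hasTrace.1

/-- The restriction of `T` to the invariant range `M` of an orthogonal projection `P` has the trace of
`T P`. -/
lemma HasNuclearTrace.restrict {T P : H →L[ℂ] H} {M : Submodule ℂ H} {τ : ℂ}
    (hP : adjoint P = P) (hPM : ∀ x, P x ∈ M) (hPx : ∀ x ∈ M, P x = x) (hT : ∀ x ∈ M, T x ∈ M)
    (h : HasNuclearTrace (T * P) τ) : HasNuclearTrace (T.restrict hT) τ := by
  have hPP : P * (T * P) = T * P := by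
    ext x
    exact hPx _ (hT _ (hPM x))
  obtain ⟨ι, a, b, hab, hs, hτ⟩ := id h
  have hnorm : Summable fun n => ‖P (a n)‖ * ‖P (b n)‖ := by
    refine (hab.mul_left (‖P‖ * ‖P‖)).of_nonneg_of_le (fun n => by positivity) fun n => ?_
    calc ‖P (a n)‖ * ‖P (b n)‖ ≤ (‖P‖ * ‖a n‖) * (‖P‖ * ‖b n‖) := by
          gcongr <;> exact P.le_opNorm _
      _ = _ := by ring
  have h1 : Summable fun n => inner ℂ (P (a n)) (P (b n)) :=
    Summable.of_norm_bounded hnorm fun n => norm_inner_le_norm _ _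
  have hin (x y : H) : inner ℂ (P x) (P y) = inner ℂ x (P y) := by
    rw [← adjoint_inner_right, hP, hPx _ (hPM y)]
  have hτ' : HasNuclearTrace (P * (T * P)) (∑' n, inner ℂ (P (a n)) (P (b n))) := by
    refine ⟨ι, a, fun n => P (b n), ?_, fun x => ?_, ?_⟩
    · refine (hab.mul_left ‖P‖).of_nonneg_of_le (fun n => by positivity) fun n => ?_
      rw [mul_left_comm]
      gcongr
      exact P.le_opNorm _
    · have := (hs x).mapL P
      simp only [map_smul] at this
      exact this
    · rw [funext fun n => (hin (a n) (b n)).symm]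
      exact h1.hasSum
  rw [hPP] at hτ'
  rw [h.unique hτ']
  refine ⟨ι, fun n => ⟨P (a n), hPM _⟩, fun n => ⟨P (b n), hPM _⟩, hnorm, fun x => ?_, h1.hasSum⟩
  have h2 := (hs x).mapL P
  have hx : P ((T * P) (x : H)) = T x := by
    change P (T (P x)) = T x
    rw [hPx _ x.2, hPx _ (hT _ x.2)]
  rw [hx] at h2
  have hin' (n : ι) : inner ℂ (⟨P (a n), hPM _⟩ : M) x = inner ℂ (a n) (x : H) := by
    change inner ℂ (P (a n)) (x : H) = _
    rw [← adjoint_inner_right, hP, hPx _ x.2]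
  rw [funext fun n => congrArg (· • (⟨P (b n), hPM _⟩ : M)) (hin' n)]
  refine (Topology.IsInducing.subtypeVal.hasSum_iff (g := M.subtype) _ _).1 ?_
  simp only [map_smul] at h2
  exact h2

lemma restrict_pow_apply {E : Type*} [NormedAddCommGroup E] [NormedSpace ℂ E] {T : E →L[ℂ] E}
    {M : Submodule ℂ E} (hT : ∀ x ∈ M, T x ∈ M) (k : ℕ) (x : M) :
    (((T.restrict hT) ^ k) x : E) = (T ^ k) x := by
  induction k with
  | zero => rfl
  | succ k ih =>
    rw [pow_succ', pow_succ']
    change T (((T.restrict hT) ^ k) x : E) = T ((T ^ k) x)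
    rw [ih]

lemma restrict_pow {E : Type*} [NormedAddCommGroup E] [NormedSpace ℂ E] {T : E →L[ℂ] E}
    {M : Submodule ℂ E} (hT : ∀ x ∈ M, T x ∈ M) (k : ℕ) :
    ∃ h : ∀ x ∈ M, (T ^ k) x ∈ M, (T.restrict hT) ^ k = (T ^ k).restrict h := by
  refine ⟨fun x hx => ?_, ?_⟩
  · rw [← restrict_pow_apply hT k ⟨x, hx⟩]
    exact Subtype.property _
  · ext x
    exact restrict_pow_apply hT k x

lemma IsHilbertSchmidt.adjoint {κ : Type} {e : HilbertBasis κ ℂ H} {A : H →L[ℂ] H}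
    (h : IsHilbertSchmidt e A) : IsHilbertSchmidt e (adjoint A) := by
  have h1 : Summable fun q : κ × κ => ‖inner ℂ (e q.2) (A (e q.1))‖ ^ 2 := by
    refine (summable_prod_of_nonneg fun q => by positivity).2
      ⟨fun i => (hasSum_norm_inner_sq e (A (e i))).summable, ?_⟩
    exact (summable_congr fun i => (hasSum_norm_inner_sq e (A (e i))).tsum_eq).2 h
  have h3 := ((summable_prod_of_nonneg fun q => sq_nonneg _).1 h1.prod_symm).2
  refine (summable_congr fun i => ?_).2 h3
  rw [← (hasSum_norm_inner_sq e _).tsum_eq]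
  refine tsum_congr fun j => ?_
  rw [adjoint_inner_right, norm_inner_symm, Prod.swap_prod_mk]

lemma IsHilbertSchmidt.isTraceClass_mul {κ : Type} {e : HilbertBasis κ ℂ H} {A B : H →L[ℂ] H}
    (hA : IsHilbertSchmidt e A) (hB : IsHilbertSchmidt e B) : IsTraceClass (A * B) := by
  refine ⟨κ, fun i => (ContinuousLinearMap.adjoint B) (e i), fun i => A (e i), ?_, fun x => ?_⟩
  · refine ((hB.adjoint.add hA).mul_left (1 / 2)).of_nonneg_of_le (fun i => by positivity)
      fun i => ?_
    nlinarith [sq_nonneg (‖(ContinuousLinearMap.adjoint B) (e i)‖ - ‖A (e i)‖)]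
  · have h := (e.hasSum_repr (B x)).mapL A
    simpa [adjoint_inner_left, e.repr_apply_apply] using h

/-- If `R` is diagonal with eigenvalues in `ℓ⁴`, then `R V R` is Hilbert-Schmidt for every bounded
`V`. The entries are `λᵢ λⱼ vᵢⱼ`, and `|λᵢ λⱼ|² ≤ (|λᵢ|⁴ + |λⱼ|⁴) / 2`, while the rows and columns of
`(vᵢⱼ)` are bounded in `ℓ²`. -/
lemma isHilbertSchmidt_sandwich {κ : Type} (e : HilbertBasis κ ℂ H) {R : H →L[ℂ] H} {l : κ → ℂ}
    (hR : ∀ i, R (e i) = l i • e i) (hRadj : ∀ i, adjoint R (e i) = conj (l i) • e i)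
    (hl : Summable fun i => ‖l i‖ ^ 4) (V : H →L[ℂ] H) : IsHilbertSchmidt e (R * V * R) := by
  have hrow (A : H →L[ℂ] H) :
      Summable fun q : κ × κ => ‖l q.1‖ ^ 4 * ‖inner ℂ (e q.2) (A (e q.1))‖ ^ 2 := by
    have hA (i : κ) := (hasSum_norm_inner_sq e (A (e i))).mul_left (‖l i‖ ^ 4)
    refine (summable_prod_of_nonneg fun q => by positivity).2 ⟨fun i => (hA i).summable, ?_⟩
    rw [funext fun i => (hA i).tsum_eq]
    refine (hl.mul_right (‖A‖ ^ 2)).of_nonneg_of_le (fun i => by positivity) fun i => ?_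
    gcongr
    simpa [e.orthonormal.1 i] using A.le_opNorm (e i)
  have h1 := hrow V
  have h2 : Summable fun q : κ × κ => ‖l q.2‖ ^ 4 * ‖inner ℂ (e q.2) (V (e q.1))‖ ^ 2 := by
    refine (summable_congr fun q => ?_).1 (hrow (adjoint V)).prod_symm
    rw [adjoint_inner_right, norm_inner_symm, Prod.fst_swap, Prod.snd_swap]
  have h3 : Summable fun q : κ × κ => ‖inner ℂ (e q.2) ((R * V * R) (e q.1))‖ ^ 2 := by
    refine ((h1.add h2).mul_left (1 / 2)).of_nonneg_of_le (fun q => by positivity) fun q => ?_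
    have : inner ℂ (e q.2) ((R * V * R) (e q.1)) =
        l q.1 * (l q.2 * inner ℂ (e q.2) (V (e q.1))) := by
      change inner ℂ (e q.2) (R (V (R (e q.1)))) = _
      rw [hR, map_smul, map_smul, inner_smul_right, ← adjoint_inner_left, hRadj, inner_smul_left,
        conj_conj]
    rw [this, norm_mul, norm_mul]
    nlinarith [mul_nonneg (sq_nonneg (‖l q.1‖ ^ 2 - ‖l q.2‖ ^ 2))
      (sq_nonneg ‖inner ℂ (e q.2) (V (e q.1))‖)]
  have h4 := ((summable_prod_of_nonneg fun q => by positivity).1 h3).2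
  exact (summable_congr fun i => (hasSum_norm_inner_sq e _).tsum_eq).1 h4

end Operators

/-! ### Spectra of compressions and transposes -/

section Spectra

open ContinuousLinearMap

variable {H : Type} [NormedAddCommGroup H] [InnerProductSpace ℂ H]

/-- Away from `0`, the spectrum of `T` restricted to the range `M` of a projection `P` is that of `T P`. -/
lemma isUnit_restrict_iff {T P : H →L[ℂ] H} {M : Submodule ℂ H} (hPM : ∀ x, P x ∈ M)
    (hPx : ∀ x ∈ M, P x = x) (hT : ∀ x ∈ M, T x ∈ M) {z : ℂ} (hz : z ≠ 0) :
    IsUnit (algebraMap ℂ (M →L[ℂ] M) z - T.restrict hT) ↔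
      IsUnit (algebraMap ℂ (H →L[ℂ] H) z - T * P) := by
  simp only [isUnit_iff_exists, Algebra.algebraMap_eq_smul_one]
  constructor
  · rintro ⟨S, h1, h2⟩
    have h1' (x : M) : z • (S x : H) - T (S x : H) = x :=
      congrArg Subtype.val (DFunLike.congr_fun h1 x)
    have h2' (x : M) (h) : (S ⟨z • (x : H) - T (x : H), h⟩ : H) = x :=
      congrArg Subtype.val (DFunLike.congr_fun h2 x)
    refine ⟨M.subtypeL ∘L S ∘L P.codRestrict M hPM + z⁻¹ • (1 - P), ?_, ?_⟩
    · ext x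
      have hPS (y : M) : P (y : H) = y := hPx _ y.2
      have hPP : P (P x) = P x := hPx _ (hPM x)
      have h3 := h1' ⟨P x, hPM x⟩
      change z • ((S ⟨P x, hPM x⟩ : H) + z⁻¹ • (x - P x)) -
        T (P ((S ⟨P x, hPM x⟩ : H) + z⁻¹ • (x - P x))) = x
      rw [map_add, hPS, map_smul, map_sub, hPP, sub_self, smul_zero, add_zero, smul_add,
        smul_inv_smul₀ hz, add_sub_right_comm, h3]
      simp
    · ext x
      have hM : z • P x - T (P x) ∈ M := M.sub_mem (M.smul_mem _ (hPM x)) (hT _ (hPM x))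
      have hy : P (z • x - T (P x)) = z • P x - T (P x) := by
        rw [map_sub, map_smul, hPx _ (hT _ (hPM x))]
      have hs : (P.codRestrict M hPM) (z • x - T (P x)) = ⟨z • P x - T (P x), hM⟩ :=
        Subtype.ext hy
      change (S ((P.codRestrict M hPM) (z • x - T (P x))) : H) +
        z⁻¹ • ((z • x - T (P x)) - P (z • x - T (P x))) = x
      rw [hs, h2' ⟨P x, hPM x⟩ hM, hy, sub_sub_sub_cancel_right, ← smul_sub, inv_smul_smul₀ hz]
      simp
  · rintro ⟨S, h1, h2⟩
    have h1' (x : H) : z • S x - T (P (S x)) = x := DFunLike.congr_fun h1 x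
    have h2' (x : H) : S (z • x - T (P x)) = x := DFunLike.congr_fun h2 x
    have hS : ∀ x ∈ M, S x ∈ M := by
      intro x hx
      have : S x = z⁻¹ • (x + T (P (S x))) := by
        rw [eq_inv_smul_iff₀ hz]
        exact sub_eq_iff_eq_add.1 (h1' x)
      rw [this]
      exact M.smul_mem _ (M.add_mem hx (hT _ (hPM _)))
    refine ⟨S.restrict hS, ?_, ?_⟩
    · ext x
      have := h1' x
      rw [hPx _ (hS _ x.2)] at this
      exact this
    · ext x
      have := h2' x
      rw [hPx _ x.2] at this
      exact this

/-- Since `⟪eᵢ, R y⟫ = lᵢ ⟪eᵢ, y⟫` with `lᵢ → 0`, the vectors `P eᵢ`, whose components along `eᵢ` are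
bounded below, are not the images under `R V` of a bounded family; so `R V` has no bounded inverse on
the range of `P`. -/
lemma zero_mem_spectrum_restrict {κ : Type*} [Infinite κ] {e : κ → H} {R V P : H →L[ℂ] H}
    {l : κ → ℂ} (he : ∀ i, ‖e i‖ = 1) (hR : ∀ i x, inner ℂ (e i) (R x) = l i * inner ℂ (e i) x)
    (hl : Filter.Tendsto (fun i => ‖l i‖) Filter.cofinite (nhds 0)) {M : Submodule ℂ H}
    (hPM : ∀ x, P x ∈ M) (hT : ∀ x ∈ M, (R * V) x ∈ M) {c : ℝ} (hc : 0 < c)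
    (hcP : ∀ i, c ≤ ‖inner ℂ (e i) (P (e i))‖) : (0 : ℂ) ∈ spectrum ℂ ((R * V).restrict hT) := by
  rw [spectrum.zero_mem_iff]
  intro hu
  obtain ⟨S, h1, -⟩ := isUnit_iff_exists.1 hu
  have hbound (i : κ) : c ≤ ‖l i‖ * (‖V‖ * (‖S‖ * ‖P‖)) := by
    set x : M := ⟨P (e i), hPM _⟩
    have hx : R (V (S x : H)) = P (e i) := congrArg Subtype.val (DFunLike.congr_fun h1 x)
    refine (hcP i).trans ?_
    rw [← hx, hR, norm_mul]
    gcongr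
    calc ‖inner ℂ (e i) (V (S x : H))‖ ≤ ‖e i‖ * ‖V (S x : H)‖ := norm_inner_le_norm _ _
      _ = ‖V (S x : H)‖ := by rw [he, one_mul]
      _ ≤ ‖V‖ * ‖S x‖ := V.le_opNorm _
      _ ≤ ‖V‖ * (‖S‖ * ‖P‖) := by
        gcongr
        refine (S.le_opNorm _).trans ?_
        gcongr
        exact (P.le_opNorm _).trans_eq (by rw [he, mul_one])
  have hlim := hl.mul_const (‖V‖ * (‖S‖ * ‖P‖))
  rw [zero_mul] at hlim
  obtain ⟨i, hi⟩ := (hlim.eventually_lt_const hc).exists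
  exact (hbound i).not_gt hi

/-- By polarization, since `J` is isometric and conjugate linear. -/
lemma inner_map_map_swap (J : H ≃ₗᵢ⋆[ℂ] H) (x y : H) : inner ℂ (J x) (J y) = inner ℂ y x := by
  have h1 : ‖J x - I • J y‖ = ‖x + I • y‖ := by
    rw [← J.norm_map (x + I • y), map_add, LinearIsometryEquiv.map_smulₛₗ]
    simp [sub_eq_add_neg]
  have h2 : ‖J x + I • J y‖ = ‖x - I • y‖ := by
    rw [← J.norm_map (x - I • y), map_sub, LinearIsometryEquiv.map_smulₛₗ]
    simp [sub_eq_add_neg]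
  rw [← inner_conj_symm y x, inner_eq_sum_norm_sq_div_four, inner_eq_sum_norm_sq_div_four x y]
  simp only [RCLike.I_to_complex] at *
  rw [h1, h2, ← map_add, ← map_sub, J.norm_map, J.norm_map]
  have h4 : conj (4 : ℂ) = 4 := map_ofNat _ 4
  simp [h4]
  ring

variable [CompleteSpace H]

/-- The transpose `J⁻¹ T* J` of `T` for the bilinear form `(x, y) ↦ ⟪J x, y⟫`, where `J` is
antiunitary. -/
def transpose (J : H ≃ₗᵢ⋆[ℂ] H) (T : H →L[ℂ] H) : H →L[ℂ] H :=
  (J.symm.toContinuousLinearEquiv : H →L⋆[ℂ] H) ∘SL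
    (adjoint T ∘SL (J.toContinuousLinearEquiv : H →L⋆[ℂ] H))

variable (J : H ≃ₗᵢ⋆[ℂ] H)

lemma transpose_apply (T : H →L[ℂ] H) (x : H) : transpose J T x = J.symm (adjoint T (J x)) := rfl

lemma transpose_mul (A B : H →L[ℂ] H) : transpose J (A * B) = transpose J B * transpose J A := by
  ext x
  have h : adjoint (A * B) = adjoint B * adjoint A := adjoint_comp A B
  simp [transpose_apply, h]

lemma transpose_one : transpose J 1 = 1 := by
  ext x
  have h : adjoint (1 : H →L[ℂ] H) = 1 := star_one _
  simp [transpose_apply, h]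

lemma transpose_sub (A B : H →L[ℂ] H) :
    transpose J (A - B) = transpose J A - transpose J B := by
  ext x
  simp [transpose_apply]

lemma transpose_add (A B : H →L[ℂ] H) :
    transpose J (A + B) = transpose J A + transpose J B := by
  ext x
  simp [transpose_apply]

lemma transpose_smul (c : ℂ) (A : H →L[ℂ] H) : transpose J (c • A) = c • transpose J A := by
  ext x
  simp [transpose_apply, LinearIsometryEquiv.map_smulₛₗ]

lemma isUnit_sub_transpose {T : H →L[ℂ] H} {z : ℂ} (h : IsUnit (algebraMap ℂ (H →L[ℂ] H) z - T)) :
    IsUnit (algebraMap ℂ (H →L[ℂ] H) z - transpose J T) := by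
  obtain ⟨S, h1, h2⟩ := isUnit_iff_exists.1 h
  have hz : transpose J (algebraMap ℂ (H →L[ℂ] H) z - T) =
      algebraMap ℂ (H →L[ℂ] H) z - transpose J T := by
    rw [transpose_sub, Algebra.algebraMap_eq_smul_one, transpose_smul, transpose_one]
  refine isUnit_iff_exists.2 ⟨transpose J S, ?_, ?_⟩
  · rw [← hz, ← transpose_mul, h2, transpose_one]
  · rw [← hz, ← transpose_mul, h1, transpose_one]

lemma HasNuclearTrace.transpose {T : H →L[ℂ] H} {τ : ℂ} (h : HasNuclearTrace T τ) :
    HasNuclearTrace (transpose J T) τ := by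
  obtain ⟨ι, a, b, hab, hs, hτ⟩ := h
  have hadj (x : H) : HasSum (fun n => inner ℂ (b n) x • a n) (adjoint T x) := by
    have hsum : Summable fun n => inner ℂ (b n) x • a n := by
      refine Summable.of_norm_bounded (hab.mul_right ‖x‖) fun n => ?_
      rw [norm_smul]
      calc ‖inner ℂ (b n) x‖ * ‖a n‖ ≤ (‖b n‖ * ‖x‖) * ‖a n‖ := by
            gcongr
            exact norm_inner_le_norm _ _
        _ = _ := by ring
    convert hsum.hasSum
    refine ext_inner_right ℂ fun y => ?_
    rw [adjoint_inner_left]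
    have h1 := (hs y).mapL (innerSL ℂ x)
    have h2 := (hsum.hasSum.mapL (innerSL ℂ y)).star
    simp only [innerSL_apply_apply, inner_smul_right] at h1 h2
    rw [RCLike.star_def, inner_conj_symm] at h2
    refine h1.unique ?_
    convert h2 using 2 with n
    rw [map_mul, inner_conj_symm, inner_conj_symm, mul_comm]
  refine ⟨ι, fun n => J.symm (b n), fun n => J.symm (a n), ?_, fun x => ?_, ?_⟩
  · simpa only [LinearIsometryEquiv.norm_map, mul_comm] using hab
  · have h1 := (hadj (J x)).map J.symm J.symm.continuous
    rw [transpose_apply]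
    convert h1 using 2 with n
    rw [Function.comp_apply, LinearIsometryEquiv.map_smulₛₗ, inner_conj_symm]
    congr 1
    conv_lhs => rw [← J.symm_apply_apply x, inner_map_map_swap J.symm]
  · simpa only [inner_map_map_swap] using hτ

/-! ### The abstract symmetry argument -/

/-- Here `P p` are orthogonal projections that `V` lowers and `R` raises, and `R`, `V`, `P p` have
transposes `-R`, `-V`, `P (-p)`. The transpose of `R V P p` is therefore `P (-p) V R`, which has the
same nonzero spectrum and the same traces of powers as `R P (-p) V = R V P (1 - p)`. -/
theorem spectrum_and_trace_symmetry {κ : Type} [Infinite κ] (e : HilbertBasis κ ℂ H)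
    {R V : H →L[ℂ] H} {P : ℤ → H →L[ℂ] H} {M : ℤ → Submodule ℂ H} {l : κ → ℂ}
    (hPadj : ∀ p, adjoint (P p) = P p) (hPM : ∀ p x, P p x ∈ M p) (hPx : ∀ p, ∀ x ∈ M p, P p x = x)
    (hVP : ∀ p, V * P p = P (p - 1) * V) (hRP : ∀ p, R * P p = P (p + 1) * R)
    (hJV : transpose J V = -V) (hJR : transpose J R = -R) (hJP : ∀ p, transpose J (P p) = P (-p))
    (hR : ∀ i, R (e i) = l i • e i) (hRadj : ∀ i, adjoint R (e i) = conj (l i) • e i)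
    (hl : Summable fun i => ‖l i‖ ^ 4) {c : ℝ} (hc : 0 < c)
    (hcP : ∀ p i, c ≤ ‖inner ℂ (e i) (P p (e i))‖) :
    ∃ hinv : ∀ p : ℤ, ∀ u ∈ M p, (R ∘L V) u ∈ M p, ∀ p : ℤ,
      spectrum ℂ ((R ∘L V).restrict (hinv p)) = spectrum ℂ ((R ∘L V).restrict (hinv (-p + 1))) ∧
      ∀ m : ℕ, 2 ≤ m → ∃ τ : ℂ, HasTrace (((R ∘L V).restrict (hinv p)) ^ (2 * m)) τ ∧
        HasTrace (((R ∘L V).restrict (hinv (-p + 1))) ^ (2 * m)) τ := by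
  have hcomm (p : ℤ) : R * V * P p = P p * (R * V) := by
    rw [mul_assoc, hVP, ← mul_assoc, hRP, sub_add_cancel, mul_assoc]
  have hinv : ∀ p : ℤ, ∀ u ∈ M p, (R * V) u ∈ M p := by
    intro p u hu
    have h : (R * V) (P p u) = P p ((R * V) u) := DFunLike.congr_fun (hcomm p) u
    rw [hPx p u hu] at h
    rw [h]
    exact hPM p _
  refine ⟨hinv, fun p => ⟨?_, fun m hm => ?_⟩⟩
  · have hl0 : Filter.Tendsto (fun i => ‖l i‖) Filter.cofinite (nhds 0) := by
      have h := hl.tendsto_cofinite_zero.rpow_const (p := 1 / 4) (Or.inr (by norm_num))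
      rw [Real.zero_rpow (by norm_num)] at h
      refine h.congr fun i => ?_
      rw [← Real.rpow_natCast, ← Real.rpow_mul (norm_nonneg _)]
      norm_num
    have hRi (i : κ) (x : H) : inner ℂ (e i) (R x) = l i * inner ℂ (e i) x := by
      rw [← adjoint_inner_left, hRadj, inner_smul_left, conj_conj]
    have h0 (q : ℤ) : (0 : ℂ) ∈ spectrum ℂ ((R * V).restrict (hinv q)) :=
      zero_mem_spectrum_restrict e.orthonormal.1 hRi hl0 (hPM q) (hinv q) hc (hcP q)
    have hle (q : ℤ) : spectrum ℂ ((R * V).restrict (hinv (-q + 1))) ⊆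
        spectrum ℂ ((R * V).restrict (hinv q)) := by
      intro z hz
      rcases eq_or_ne z 0 with rfl | hz0
      · exact h0 q
      rw [spectrum.mem_iff, isUnit_restrict_iff (hPM _) (hPx _) _ hz0] at hz ⊢
      intro hu
      apply hz
      have h1 := isUnit_sub_transpose J hu
      have h2 : transpose J (R * V * P q) = (P (-q) * V) * R := by
        rw [transpose_mul, transpose_mul, hJV, hJR, hJP]
        noncomm_ring
      have h3 : R * V * P (-q + 1) = R * (P (-q) * V) := by
        rw [mul_assoc, hVP, add_sub_cancel_right]
      rw [h2] at h1
      by_contra h4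
      have h5 : z ∈ spectrum ℂ (R * (P (-q) * V)) \ {0} := ⟨by rwa [spectrum.mem_iff, ← h3], hz0⟩
      rw [spectrum.nonzero_mul_comm] at h5
      exact h5.1 h1
    refine Set.Subset.antisymm ?_ (hle p)
    have h := hle (-p + 1)
    -- The index `p` occurs in the proof `hinv p`, which rules out rewriting.
    generalize hq : -(-p + 1) + 1 = q at h
    obtain rfl : p = q := by lia
    exact h
  · -- `K = R (V R)^(2m-1)` is trace class, `Kᵗ = -K` and `(R V)^(2m) = K V`, so that the transpose of
    -- `(R V)^(2m) P p = K (V P p)` is `V P (1 - p) K`.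
    obtain ⟨k, rfl⟩ := Nat.exists_eq_add_of_le hm
    have hflip (n : ℕ) : R * (V * R) ^ n = (R * V) ^ n * R := (mul_pow_mul R V n).symm
    set K : H →L[ℂ] H := R * (V * R) ^ (3 + 2 * k) with hK
    have hS := isHilbertSchmidt_sandwich e hR hRadj hl V
    have hKtc : IsTraceClass K := by
      have h : K = (R * V * R) * (V * (R * V * R)) * (V * R) ^ (2 * k) := by
        rw [hK, pow_add, pow_succ, pow_two]
        simp only [mul_assoc]
      rw [h]
      exact (hS.isTraceClass_mul (hS.mul_left V)).mul_right _
    have hpow : (R * V) ^ (2 * (2 + k)) = K * V := by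
      rw [hK, hflip, mul_assoc, ← pow_succ]
      congr 1
      ring
    have hKt : transpose J K = -K := by
      have hVR : transpose J (V * R) = R * V := by rw [transpose_mul, hJV, hJR, neg_mul_neg]
      have hn (n : ℕ) : transpose J ((V * R) ^ n) = (R * V) ^ n := by
        induction n with
        | zero => simp [transpose_one]
        | succ n ih => rw [pow_succ, transpose_mul, ih, hVR, ← pow_succ']
      rw [hK, transpose_mul, hn, hJR, mul_neg, hflip]
    obtain ⟨τ, h1, -⟩ := hKtc.exists_trace_mul_comm (V * P p)
    obtain ⟨τ', h2, h3⟩ := hKtc.exists_trace_mul_comm (V * P (-p + 1))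
    have h4 : transpose J (K * (V * P p)) = V * P (-p + 1) * K := by
      rw [transpose_mul, transpose_mul, hKt, hJV, hJP, hVP, add_sub_cancel_right]
      noncomm_ring
    have h5 := h1.transpose J
    rw [h4] at h5
    obtain rfl := h5.unique h3
    refine ⟨τ, ?_, ?_⟩
    · obtain ⟨h, hr⟩ := restrict_pow (hinv p) (2 * (2 + k))
      change HasTrace (((R * V).restrict (hinv p)) ^ (2 * (2 + k))) τ
      rw [hr]
      refine (HasNuclearTrace.restrict (hPadj p) (hPM p) (hPx p) h ?_).hasTrace
      rwa [hpow, mul_assoc]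
    · obtain ⟨h, hr⟩ := restrict_pow (hinv (-p + 1)) (2 * (2 + k))
      change HasTrace (((R * V).restrict (hinv (-p + 1))) ^ (2 * (2 + k))) τ
      rw [hr]
      refine (HasNuclearTrace.restrict (hPadj _) (hPM _) (hPx _) h ?_).hasTrace
      rwa [hpow, mul_assoc]

end Spectra

/-! ### Lattice coordinates and the torus -/

/-- The real coordinates `(s, t)` of `z = s ω + t`. -/
def latticeCoord : ℂ ≃L[ℝ] (Fin 2 → ℝ) :=
  LinearEquiv.toContinuousLinearEquiv
    { toFun := fun z => ![z.im / omega.im, z.re - z.im / omega.im * omega.re]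
      invFun := fun x => x 0 * omega + x 1
      map_add' := fun z w => by
        ext i
        fin_cases i <;> simp <;> ring
      map_smul' := fun c z => by
        ext i
        fin_cases i <;> simp <;> ring
      left_inv := fun z => by
        have ho : omega.im ≠ 0 := by rw [omega_im]; positivity
        apply Complex.ext <;> simp [ho]
      right_inv := fun x => by
        have ho : omega.im ≠ 0 := by rw [omega_im]; positivity
        ext i
        fin_cases i <;> simp [ho] }

lemma latticeCoord_symm_apply (x : Fin 2 → ℝ) : latticeCoord.symm x = x 0 * omega + x 1 := rfl

lemma latticeCoord_apply_combination (x y : ℝ) : latticeCoord (x * omega + y) = ![x, y] := by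
  rw [← latticeCoord.apply_symm_apply ![x, y], latticeCoord_symm_apply]
  simp

lemma mem_cell_iff (z : ℂ) : z ∈ cell ↔ ∀ i, latticeCoord z i ∈ Set.Ico (0 : ℝ) 1 := by
  rw [cell_eq, Fin.forall_fin_two]
  rfl

lemma latticeCoord_lattice {γ : ℂ} (hγ : γ ∈ lattice) (i : Fin 2) :
    ∃ a : ℤ, latticeCoord γ i = a := by
  obtain ⟨a, b, rfl⟩ := hγ
  have h := latticeCoord_apply_combination a b
  push_cast at h
  rw [h]
  fin_cases i
  · exact ⟨a, rfl⟩
  · exact ⟨b, rfl⟩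

/-- The normalized Haar measure on the torus `ℝ² / ℤ²`. -/
abbrev torusMeasure : Measure (UnitAddTorus (Fin 2)) :=
  Measure.pi fun _ => AddCircle.haarAddCircle

/-- The quotient map `ℂ → ℂ / Λ`, with `ℂ / Λ` identified with the standard torus. -/
def toTorus (z : ℂ) : UnitAddTorus (Fin 2) := fun i => (latticeCoord z i : UnitAddCircle)

lemma measurable_toTorus : Measurable toTorus :=
  measurable_pi_lambda _ fun i => AddCircle.measurable_mk'.comp
    ((measurable_pi_apply i).comp latticeCoord.continuous.measurable)

/-- The constant `k` is the area of the cell: Lebesgue measure in the coordinates `latticeCoord` is a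
Haar measure, hence a multiple of the standard one. -/
lemma exists_map_toTorus : ∃ k : NNReal, k ≠ 0 ∧ volume cell = k ∧
    (volume.restrict cell).map toTorus = k • torusMeasure := by
  set k := ((volume : Measure ℂ).map latticeCoord).addHaarScalarFactor
    (volume : Measure (Fin 2 → ℝ))
  have hk : (volume : Measure ℂ).map latticeCoord = k • (volume : Measure (Fin 2 → ℝ)) :=
    Measure.isAddLeftInvariant_eq_smul _ _
  suffices h : (volume.restrict cell).map toTorus = k • torusMeasure by
    refine ⟨k, (Measure.addHaarScalarFactor_pos_of_isAddHaarMeasure _ _).ne', ?_, h⟩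
    have h1 : (volume.restrict cell).map toTorus Set.univ = (k • torusMeasure) Set.univ := by rw [h]
    rw [Measure.map_apply measurable_toTorus MeasurableSet.univ, Set.preimage_univ,
      Measure.restrict_apply_univ, Measure.smul_apply, measure_univ, ENNReal.smul_def, smul_eq_mul,
      mul_one] at h1
    exact h1
  have hcell : cell = latticeCoord ⁻¹' (Set.univ.pi fun _ => Set.Ico (0 : ℝ) 1) := by
    ext z
    simp [mem_cell_iff]
  have h1 : (volume.restrict cell).map latticeCoord =
      k • Measure.pi fun _ : Fin 2 => volume.restrict (Set.Ico (0 : ℝ) 1) := by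
    rw [hcell, ← Measure.restrict_map latticeCoord.continuous.measurable
      (MeasurableSet.univ_pi fun _ => measurableSet_Ico), hk, Measure.restrict_smul, volume_pi,
      Measure.restrict_pi_pi]
  have h2 : MeasurePreserving (fun (x : Fin 2 → ℝ) i => (x i : UnitAddCircle))
      (Measure.pi fun _ : Fin 2 => volume.restrict (Set.Ico (0 : ℝ) 1)) torusMeasure := by
    refine measurePreserving_pi _ _ fun _ => ?_
    have h := AddCircle.measurePreserving_mk 1 0
    rw [AddCircle.volume_eq_smul_haarAddCircle, ENNReal.ofReal_one, one_smul, zero_add] at h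
    rwa [restrict_Ico_eq_restrict_Ioc]
  have h3 : toTorus = (fun (x : Fin 2 → ℝ) i => (x i : UnitAddCircle)) ∘ latticeCoord := rfl
  rw [h3, ← Measure.map_map h2.measurable latticeCoord.continuous.measurable, h1,
    Measure.map_smul, h2.map_eq]

lemma volume_cell_ne_zero_and_top : volume cell ≠ 0 ∧ volume cell ≠ ⊤ := by
  obtain ⟨k, hk, h, -⟩ := exists_map_toTorus
  rw [h]
  exact ⟨by simpa using hk, ENNReal.coe_ne_top⟩

instance : IsFiniteMeasure (volume.restrict cell) :=
  ⟨by rw [Measure.restrict_apply_univ]; exact volume_cell_ne_zero_and_top.2.lt_top⟩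

/-- The area of the fundamental cell. -/
def cellArea : ℝ := volume.real cell

lemma cellArea_pos : 0 < cellArea :=
  ENNReal.toReal_pos volume_cell_ne_zero_and_top.1 volume_cell_ne_zero_and_top.2

lemma map_toTorus : (volume.restrict cell).map toTorus = volume cell • torusMeasure := by
  obtain ⟨k, hk, h, h1⟩ := exists_map_toTorus
  rw [h1, h]
  rfl

lemma setIntegral_cell_comp_toTorus {f : UnitAddTorus (Fin 2) → ℂ}
    (hf : AEStronglyMeasurable f torusMeasure) :
    ∫ z in cell, f (toTorus z) = cellArea * ∫ x, f x ∂torusMeasure := by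
  rw [← integral_map measurable_toTorus.aemeasurable, map_toTorus, integral_smul_measure]
  · simp [cellArea, Measure.real]
  · rw [map_toTorus]
    exact hf.smul_measure _

/-- The section of `toTorus` with values in the fundamental cell. -/
def fromTorus (x : UnitAddTorus (Fin 2)) : ℂ :=
  latticeCoord.symm fun i => (AddCircle.measurableEquivIco 1 0 (x i) : ℝ)

lemma measurable_fromTorus : Measurable fromTorus :=
  latticeCoord.symm.continuous.measurable.comp <| measurable_pi_lambda _ fun i =>
    measurable_subtype_coe.comp
      ((AddCircle.measurableEquivIco 1 0).measurable.comp (measurable_pi_apply i))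

lemma coord_fromTorus_toTorus (z : ℂ) (i : Fin 2) :
    latticeCoord (fromTorus (toTorus z)) i = Int.fract (latticeCoord z i) := by
  rw [fromTorus, latticeCoord.apply_symm_apply]
  change ((AddCircle.equivIco 1 0 (latticeCoord z i : UnitAddCircle) : Set.Ico (0 : ℝ) (0 + 1)) : ℝ)
    = _
  rw [AddCircle.coe_equivIco_mk_apply]
  simp

lemma fromTorus_toTorus {z : ℂ} (hz : z ∈ cell) : fromTorus (toTorus z) = z := by
  apply latticeCoord.injective
  ext i
  rw [coord_fromTorus_toTorus, Int.fract_eq_self.2 ((mem_cell_iff z).1 hz i)]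

lemma toTorus_add_lattice {γ : ℂ} (hγ : γ ∈ lattice) (z : ℂ) : toTorus (z + γ) = toTorus z := by
  ext i
  obtain ⟨a, ha⟩ := latticeCoord_lattice hγ i
  rw [toTorus, toTorus, map_add, Pi.add_apply, ha, AddCircle.coe_add]
  have : ((a : ℝ) : UnitAddCircle) = 0 := AddCircle.coe_eq_zero_iff (p := (1 : ℝ)) |>.2 ⟨a, by simp⟩
  rw [this, add_zero]

/-- The Hilbert basis of Fourier modes on the torus. -/
def torusBasis : HilbertBasis (Fin 2 → ℤ) ℂ (Lp ℂ 2 torusMeasure) := UnitAddTorus.mFourierBasis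

lemma torusBasis_ae (n : Fin 2 → ℤ) : torusBasis n =ᵐ[torusMeasure] UnitAddTorus.mFourier n := by
  rw [show torusBasis = UnitAddTorus.mFourierBasis from rfl, UnitAddTorus.coe_mFourierBasis]
  exact UnitAddTorus.coeFn_mFourierLp 2 n

lemma integral_mFourier_mul (m n : Fin 2 → ℤ) :
    ∫ x, conj (UnitAddTorus.mFourier m x) * UnitAddTorus.mFourier n x ∂torusMeasure =
      if m = n then 1 else 0 := by
  rw [← orthonormal_iff_ite.1 torusBasis.orthonormal m n, L2.inner_def]
  refine integral_congr_ae ?_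
  filter_upwards [torusBasis_ae m, torusBasis_ae n] with x h1 h2
  rw [h1, h2, RCLike.inner_apply, mul_comm]

lemma ae_eq_zero_of_fourier {f : UnitAddTorus (Fin 2) → ℂ} (hf : MemLp f 2 torusMeasure)
    (h : ∀ n, ∫ x, conj (UnitAddTorus.mFourier n x) * f x ∂torusMeasure = 0) :
    f =ᵐ[torusMeasure] 0 := by
  have h0 : hf.toLp f = 0 := by
    rw [← torusBasis.repr.map_eq_zero_iff]
    ext n
    rw [HilbertBasis.repr_apply_apply, L2.inner_def, lp.coeFn_zero, Pi.zero_apply, ← h n]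
    refine integral_congr_ae ?_
    filter_upwards [torusBasis_ae n, hf.coeFn_toLp] with x h1 h2
    rw [h1, h2, RCLike.inner_apply, mul_comm]
  exact (Lp.eq_zero_iff_ae_eq_zero.1 h0) |> hf.coeFn_toLp.symm.trans

/-! ### Bounded sets are covered by finitely many cells -/

lemma exists_lintegral_le_cell {S : Set ℂ} (hS : IsCompact S) : ∃ N : ℕ, ∀ g : ℂ → ℝ≥0∞,
    (∀ γ ∈ lattice, ∀ᵐ z : ℂ, g (z + γ) = g z) → ∫⁻ z in S, g z ≤ N * ∫⁻ z in cell, g z := by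
  obtain ⟨r, hr⟩ := (hS.image latticeCoord.continuous).isBounded.exists_norm_le
  obtain ⟨n, hn⟩ := exists_nat_gt r
  set F := ↥(Finset.Icc (-(n + 1 : ℤ)) (n + 1) ×ˢ Finset.Icc (-(n + 1 : ℤ)) (n + 1))
  have hcov : S ⊆ ⋃ q : F, (fun z => z + (q.1.1 * omega + q.1.2)) ⁻¹' cell := by
    intro z hz
    obtain ⟨a, b, hab⟩ := exists_translate_mem_cell z
    have hbd (i : Fin 2) : |latticeCoord z i| < n :=
      ((norm_le_pi_norm (latticeCoord z) i).trans (hr _ ⟨z, hz, rfl⟩)).trans_lt hn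
    have h1 := (mem_cell_iff _).1 hab
    have h2 := latticeCoord_apply_combination a b
    push_cast at h2
    simp only [map_add, h2, Pi.add_apply, Set.mem_Ico] at h1
    have h3 := h1 0
    have h4 := h1 1
    have h5 := abs_lt.1 (hbd 0)
    have h6 := abs_lt.1 (hbd 1)
    simp only [Matrix.cons_val_zero, Matrix.cons_val_one] at h3 h4
    have key {y : ℝ} {d : ℤ} (hy : -(n : ℝ) < y ∧ y < n) (hd : 0 ≤ y + d ∧ y + d < 1) :
        -(n + 1 : ℤ) ≤ d ∧ d ≤ n + 1 := by
      have h1 : (-(n + 1) : ℝ) ≤ d := by linarith [hy.2, hd.1]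
      have h2 : (d : ℝ) ≤ n + 1 := by linarith [hy.1, hd.2]
      exact ⟨by exact_mod_cast h1, by exact_mod_cast h2⟩
    refine Set.mem_iUnion.2 ⟨⟨(a, b), ?_⟩, hab⟩
    rw [Finset.mem_product, Finset.mem_Icc, Finset.mem_Icc]
    exact ⟨key h5 h3, key h6 h4⟩
  refine ⟨Fintype.card F, fun g hg => ?_⟩
  calc ∫⁻ z in S, g z ≤ ∑' q : F, ∫⁻ z in (fun z => z + (q.1.1 * omega + q.1.2)) ⁻¹' cell, g z :=
        (lintegral_mono_set hcov).trans (lintegral_iUnion_le _ _)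
    _ = ∑' q : F, ∫⁻ z in cell, g z := by
        refine tsum_congr fun q => ?_
        rw [← (measurePreserving_add_right volume
          (q.1.1 * omega + q.1.2 : ℂ)).setLIntegral_comp_preimage_emb
          (measurableEmbedding_addRight _) g cell]
        refine lintegral_congr_ae (ae_restrict_of_ae ?_)
        filter_upwards [hg _ ⟨q.1.1, q.1.2, rfl⟩] with z hz using hz.symm
    _ = _ := by simp [tsum_fintype]

/-! ### Plane waves -/

/-- The plane wave `exp (2πi (a₀ s + a₁ t))` in the coordinates `z = s ω + t`. -/
def planeWave (a : Fin 2 → ℝ) (z : ℂ) : ℂ :=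
  exp ((2 * Real.pi * (a 0 * latticeCoord z 0 + a 1 * latticeCoord z 1) : ℝ) * I)

lemma norm_planeWave (a : Fin 2 → ℝ) (z : ℂ) : ‖planeWave a z‖ = 1 := norm_exp_ofReal_mul_I _

lemma planeWave_ne_zero (a : Fin 2 → ℝ) (z : ℂ) : planeWave a z ≠ 0 := exp_ne_zero _

lemma conj_planeWave (a : Fin 2 → ℝ) (z : ℂ) : conj (planeWave a z) = planeWave (-a) z := by
  rw [planeWave, planeWave, ← exp_conj, map_mul, conj_ofReal, conj_I]
  congr 1
  push_cast [Pi.neg_apply]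
  ring

lemma conj_planeWave_mul_self (a : Fin 2 → ℝ) (z : ℂ) : conj (planeWave a z) * planeWave a z = 1 := by
  rw [mul_comm, mul_conj, normSq_eq_norm_sq, norm_planeWave]
  simp

lemma planeWave_mul (a b : Fin 2 → ℝ) (z : ℂ) :
    planeWave a z * planeWave b z = planeWave (a + b) z := by
  rw [planeWave, planeWave, planeWave, ← exp_add]
  congr 1
  push_cast [Pi.add_apply]
  ring

lemma planeWave_add (a : Fin 2 → ℝ) (z w : ℂ) :
    planeWave a (z + w) = planeWave a z * planeWave a w := by
  rw [planeWave, planeWave, planeWave, ← exp_add]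
  congr 1
  push_cast [map_add, Pi.add_apply]
  ring

lemma contDiff_planeWave (a : Fin 2 → ℝ) : ContDiff ℝ ∞ (planeWave a) := by
  have h (i : Fin 2) : ContDiff ℝ ∞ fun z => latticeCoord z i :=
    (contDiff_apply ℝ ℝ i).comp latticeCoord.contDiff
  have h2 : ContDiff ℝ ∞ fun z => 2 * Real.pi * (a 0 * latticeCoord z 0 + a 1 * latticeCoord z 1) :=
    contDiff_const.mul ((contDiff_const.mul (h 0)).add (contDiff_const.mul (h 1)))
  exact Complex.contDiff_exp.comp ((ofRealCLM.contDiff.comp h2).mul contDiff_const)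

lemma continuous_planeWave (a : Fin 2 → ℝ) : Continuous (planeWave a) :=
  (contDiff_planeWave a).continuous

lemma planeWave_intCast (n : Fin 2 → ℤ) (z : ℂ) :
    planeWave (fun j => n j) z = UnitAddTorus.mFourier n (toTorus z) := by
  simp only [UnitAddTorus.mFourier, ContinuousMap.coe_mk, Fin.prod_univ_two, toTorus, fourier_coe_apply,
    planeWave, ← exp_add]
  congr 1
  push_cast
  ring

/-- The offset of the frequencies in the component `c`: the components of an element of `L²_0` have
the multipliers of plane waves with frequencies in `ℤ² + (1/3, 1/3)` and `ℤ² - (1/3, 1/3)`. -/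
def freqShift (c : Fin 2) : ℝ := ![1 / 3, -1 / 3] c

/-- The frequencies in the component `c` of `L²_0`, in the basis dual to `(ω, 1)`. -/
def freq (c : Fin 2) (n : Fin 2 → ℤ) : Fin 2 → ℝ := fun j => n j + freqShift c

lemma chi_eq_exp (a b : ℤ) :
    chi (a * omega + b) = exp ((2 * Real.pi * (2 * b - a) / 3 : ℝ) * I) := by
  have h : pairing (a * omega + b) diracK = (a * (-1 / 2) + b) * (4 / 3 * Real.pi) := by
    rw [pairing, diracK, conj_ofReal, re_mul_ofReal]
    simp [omega_re]
  rw [chi, h]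
  congr 1
  push_cast
  ring

lemma norm_chi (γ : ℂ) : ‖chi γ‖ = 1 := by
  rw [chi, mul_comm, norm_exp_ofReal_mul_I]

lemma conj_chi (γ : ℂ) : conj (chi γ) = (chi γ)⁻¹ := by
  rw [Complex.inv_def, normSq_eq_norm_sq, norm_chi]
  simp

/-- In each component, the multiplier of `L²_0` is that of the plane waves `planeWave (freq c n)`. -/
lemma rho_apply {γ : ℂ} (hγ : γ ∈ lattice) (n : Fin 2 → ℤ) (c : Fin 2) (v : E2) :
    rho γ v c = conj (planeWave (freq c n) γ) * v c := by
  obtain ⟨a, b, rfl⟩ := hγ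
  have h := latticeCoord_apply_combination a b
  push_cast at h
  rw [conj_planeWave, planeWave, h]
  fin_cases c
  · simp only [rho, freq, freqShift, Fin.zero_eta, Pi.neg_apply, Matrix.cons_val_zero, Matrix.cons_val_one]
    rw [chi_eq_exp]
    congr 1
    rw [exp_eq_exp_iff_exists_int]
    refine ⟨b + n 0 * a + n 1 * b, ?_⟩
    push_cast
    ring
  · simp only [rho, freq, freqShift, Fin.mk_one, Pi.neg_apply, Matrix.cons_val_zero, Matrix.cons_val_one]
    rw [chi_eq_exp, ← exp_neg]
    congr 1
    rw [exp_eq_exp_iff_exists_int]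
    refine ⟨-b + n 0 * a + n 1 * b, ?_⟩
    push_cast
    ring

lemma norm_rho (γ : ℂ) (v : E2) : ‖rho γ v‖ = ‖v‖ := by
  simp [EuclideanSpace.norm_eq, rho, norm_chi]

/-! ### Elements of `L²_0` -/

/-- The function underlying an element of `L²_0`. -/
abbrev fn (u : L2zero) : ℂ → E2 := ((u : ℂ →ₘ[volume] E2) : ℂ → E2)

lemma measurable_fn (u : L2zero) (c : Fin 2) : Measurable fun z => fn u z c :=
  ((EuclideanSpace.proj (𝕜 := ℂ) c).continuous.comp_stronglyMeasurable
    (AEEqFun.stronglyMeasurable (u : ℂ →ₘ[volume] E2))).measurable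

lemma L2zero_ext {u v : L2zero} (h : ∀ᵐ z, fn u z = fn v z) : u = v :=
  Subtype.ext (AEEqFun.ext h)

lemma fn_add (u v : L2zero) : ∀ᵐ z, fn (u + v) z = fn u z + fn v z :=
  AEEqFun.coeFn_add (u : ℂ →ₘ[volume] E2) (v : ℂ →ₘ[volume] E2)

lemma fn_smul (c : ℂ) (u : L2zero) : ∀ᵐ z, fn (c • u) z = c • fn u z :=
  AEEqFun.coeFn_smul c (u : ℂ →ₘ[volume] E2)

lemma norm_eq_eLpNorm (u : L2zero) :
    ENNReal.ofReal ‖u‖ = eLpNorm (fn u) 2 (volume.restrict cell) := by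
  change ENNReal.ofReal ‖toCell u‖ = _
  rw [show toCell u = (memLp_cell u).toLp _ from rfl, Lp.norm_toLp,
    ENNReal.ofReal_toReal (memLp_cell u).2.ne]

/-- A quasi-periodic function that is square integrable on the cell is locally square integrable,
because a compact set is covered by finitely many translates of the cell. -/
lemma mem_L2zeroSub {f : ℂ → E2} (hf : AEStronglyMeasurable f volume)
    (hc : MemLp f 2 (volume.restrict cell))
    (hper : ∀ γ ∈ lattice, ∀ᵐ z : ℂ, rho γ (f (z + γ)) = f z) :
    AEEqFun.mk f hf ∈ L2zeroSub := by
  have h0 := AEEqFun.coeFn_mk f hf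
  refine ⟨fun S hS => ?_, fun γ hγ => ?_⟩
  · refine (memLp_congr_ae (ae_restrict_of_ae h0)).2 ⟨hf.restrict, ?_⟩
    obtain ⟨N, hN⟩ := exists_lintegral_le_cell hS
    have h2 := hN (fun z => ‖f z‖ₑ ^ (2 : ℝ)) fun γ hγ => by
      filter_upwards [hper γ hγ] with z hz
      rw [← hz, ← ofReal_norm, ← ofReal_norm, norm_rho]
    have h3 := hc.2
    rw [eLpNorm_lt_top_iff_lintegral_rpow_enorm_lt_top two_ne_zero ENNReal.ofNat_ne_top,
      ENNReal.toReal_ofNat] at h3 ⊢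
    exact h2.trans_lt (ENNReal.mul_lt_top (ENNReal.natCast_lt_top N) h3)
  · filter_upwards [h0, ae_translate γ h0, hper γ hγ] with z h1 h2 h3
    rw [h1, h2, h3]

lemma measurable_toLp_E2 {g : ℂ → Fin 2 → ℂ} (hg : ∀ c, Measurable fun z => g z c) :
    Measurable fun z => (WithLp.toLp 2 (g z) : E2) :=
  (WithLp.measurable_toLp 2 (Fin 2 → ℂ)).comp (measurable_pi_lambda _ hg)

/-- A square integrable function on the cell is divided by a plane wave with the right multiplier,
extended periodically, and multiplied by the plane wave again. -/
lemma toCell_surjective : Function.Surjective toCell := by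
  intro f
  have hfm (c : Fin 2) : Measurable fun z => f z c :=
    ((EuclideanSpace.proj (𝕜 := ℂ) c).continuous.comp_stronglyMeasurable
      (Lp.stronglyMeasurable f)).measurable
  set F : ℂ → E2 := fun z => WithLp.toLp 2 fun c => planeWave (freq c 0) z *
    (conj (planeWave (freq c 0) (fromTorus (toTorus z))) * f (fromTorus (toTorus z)) c) with hF
  have hmeas : Measurable F := by
    have hft : Measurable fun z => fromTorus (toTorus z) :=
      measurable_fromTorus.comp measurable_toTorus
    refine measurable_toLp_E2 fun c => (continuous_planeWave _).measurable.mul ?_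
    refine Measurable.mul ?_ ((hfm c).comp hft)
    exact continuous_conj.measurable.comp ((continuous_planeWave _).measurable.comp hft)
  have hFf : F =ᵐ[volume.restrict cell] f := by
    filter_upwards [ae_restrict_mem measurableSet_cell] with z hz
    ext c
    rw [hF]
    simp only
    rw [fromTorus_toTorus hz, ← mul_assoc, mul_comm (planeWave _ _), conj_planeWave_mul_self,
      one_mul]
  have hmem : AEEqFun.mk F hmeas.aestronglyMeasurable ∈ L2zeroSub := by
    refine mem_L2zeroSub _ ((memLp_congr_ae hFf).2 (Lp.memLp f)) fun γ hγ =>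
      ae_of_all _ fun z => ?_
    ext c
    rw [rho_apply hγ 0, hF]
    simp only
    rw [planeWave_add, toTorus_add_lattice hγ]
    linear_combination (planeWave (freq c 0) z * (conj (planeWave (freq c 0)
      (fromTorus (toTorus z))) * f (fromTorus (toTorus z)) c)) *
      conj_planeWave_mul_self (freq c 0) γ
  have h1 : (AEEqFun.mk F hmeas.aestronglyMeasurable : ℂ → E2) =ᵐ[volume.restrict cell] F :=
    ae_restrict_of_ae (AEEqFun.coeFn_mk F _)
  exact ⟨⟨_, hmem⟩, Lp.ext ((memLp_cell ⟨_, hmem⟩).coeFn_toLp.trans (h1.trans hFf))⟩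

instance : CompleteSpace L2zero := by
  let e : L2zero ≃ₗᵢ[ℂ] Lp E2 2 (volume.restrict cell) :=
    LinearIsometryEquiv.ofSurjective ⟨toCell, fun _ => rfl⟩ toCell_surjective
  exact e.toIsometryEquiv.completeSpace

/-! ### The Fourier basis -/

/-- The plane wave `planeWave (freq c n)` in the component `c`, normalized in `L²_0`. -/
def modeFun (i : Fin 2 × (Fin 2 → ℤ)) (z : ℂ) : E2 :=
  ((√cellArea : ℝ) : ℂ)⁻¹ • planeWave (freq i.1 i.2) z • EuclideanSpace.single i.1 1

lemma continuous_modeFun (i : Fin 2 × (Fin 2 → ℤ)) : Continuous (modeFun i) := by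
  have h := continuous_planeWave (freq i.1 i.2)
  unfold modeFun
  fun_prop

lemma modeFun_mem (i : Fin 2 × (Fin 2 → ℤ)) :
    AEEqFun.mk (modeFun i) (continuous_modeFun i).aestronglyMeasurable ∈ L2zeroSub := by
  refine mem_L2zeroSub _ ?_ fun γ hγ => ae_of_all _ fun z => ?_
  · refine MemLp.of_bound (continuous_modeFun i).aestronglyMeasurable
      ‖((√cellArea : ℝ) : ℂ)⁻¹‖ (ae_of_all _ fun z => ?_)
    rw [modeFun, norm_smul, norm_smul, norm_planeWave]
    simp
  · ext c
    rw [rho_apply hγ i.2]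
    simp only [modeFun, PiLp.smul_apply, smul_eq_mul, planeWave_add, PiLp.single_apply]
    split_ifs with h
    · subst h
      linear_combination ((√cellArea : ℝ) : ℂ)⁻¹ * planeWave (freq i.1 i.2) z *
        conj_planeWave_mul_self (freq i.1 i.2) γ
    · simp

/-- `modeFun i` as an element of `L²_0`. -/
def mode (i : Fin 2 × (Fin 2 → ℤ)) : L2zero := ⟨_, modeFun_mem i⟩

lemma fn_mode (i : Fin 2 × (Fin 2 → ℤ)) : ∀ᵐ z, fn (mode i) z = modeFun i z :=
  AEEqFun.coeFn_mk _ _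

lemma inner_mode (i : Fin 2 × (Fin 2 → ℤ)) (u : L2zero) : inner ℂ (mode i) u =
    ((√cellArea : ℝ) : ℂ)⁻¹ * ∫ z in cell, conj (planeWave (freq i.1 i.2) z) * fn u z i.1 := by
  rw [inner_eq, ← integral_const_mul]
  refine integral_congr_ae (ae_restrict_of_ae ?_)
  filter_upwards [fn_mode i] with z hz
  change inner ℂ (fn (mode i) z) (fn u z) = _
  rw [hz, modeFun, inner_smul_left, inner_smul_left, EuclideanSpace.inner_single_left]
  simp

lemma planeWave_freq (c : Fin 2) (n : Fin 2 → ℤ) (z : ℂ) : planeWave (freq c n) z =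
    planeWave (freq c 0) z * UnitAddTorus.mFourier n (toTorus z) := by
  rw [← planeWave_intCast, planeWave_mul]
  congr 1
  ext j
  simp [freq, add_comm]

lemma setIntegral_cell_planeWave (c : Fin 2) (m n : Fin 2 → ℤ) :
    ∫ z in cell, conj (planeWave (freq c m) z) * planeWave (freq c n) z =
      if m = n then (cellArea : ℂ) else 0 := by
  have h (z : ℂ) : conj (planeWave (freq c m) z) * planeWave (freq c n) z =
      conj (UnitAddTorus.mFourier m (toTorus z)) * UnitAddTorus.mFourier n (toTorus z) := by
    rw [planeWave_freq c m, planeWave_freq c n, map_mul]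
    linear_combination conj (UnitAddTorus.mFourier m (toTorus z)) *
      UnitAddTorus.mFourier n (toTorus z) * conj_planeWave_mul_self (freq c 0) z
  simp only [h]
  rw [setIntegral_cell_comp_toTorus
    (f := fun x => conj (UnitAddTorus.mFourier m x) * UnitAddTorus.mFourier n x)
    (by exact Continuous.aestronglyMeasurable (by fun_prop)), integral_mFourier_mul]
  simp

lemma orthonormal_mode : Orthonormal ℂ mode := by
  classical
  rw [orthonormal_iff_ite]
  rintro ⟨c, m⟩ ⟨d, n⟩
  rw [inner_mode]
  have h1 : ∫ z in cell, conj (planeWave (freq c m) z) * fn (mode (d, n)) z c =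
      ∫ z in cell, (if c = d then ((√cellArea : ℝ) : ℂ)⁻¹ else 0) *
        (conj (planeWave (freq c m) z) * planeWave (freq c n) z) := by
    refine integral_congr_ae (ae_restrict_of_ae ?_)
    filter_upwards [fn_mode (d, n)] with z hz
    rw [hz]
    simp only [modeFun, PiLp.smul_apply, smul_eq_mul, PiLp.single_apply]
    split_ifs with h
    · subst h
      ring
    · simp
  have hA : ((√cellArea : ℝ) : ℂ)⁻¹ * (((√cellArea : ℝ) : ℂ)⁻¹ * (cellArea : ℂ)) = 1 := by
    rw [← mul_assoc, ← mul_inv, ← ofReal_mul, Real.mul_self_sqrt cellArea_pos.le]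
    exact inv_mul_cancel₀ (ofReal_ne_zero.2 cellArea_pos.ne')
  rw [h1, integral_const_mul, setIntegral_cell_planeWave]
  by_cases h : c = d <;> by_cases h' : m = n <;> simp [h, h', hA]

lemma eq_zero_of_inner_mode {u : L2zero} (h : ∀ i, inner ℂ (mode i) u = 0) : u = 0 := by
  have hA : ((√cellArea : ℝ) : ℂ)⁻¹ ≠ 0 :=
    inv_ne_zero (ofReal_ne_zero.2 (Real.sqrt_pos.2 cellArea_pos).ne')
  have hc (c : Fin 2) : ∀ᵐ z ∂(volume.restrict cell), fn u z c = 0 := by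
    -- Dividing by the plane wave of index `0` leaves a periodic function, to which the completeness of
    -- the Fourier basis on the torus applies.
    set G : ℂ → ℂ := fun z => conj (planeWave (freq c 0) z) * fn u z c with hG
    have hGm : Measurable G :=
      (continuous_conj.measurable.comp (continuous_planeWave _).measurable).mul (measurable_fn u c)
    have hGt : Measurable fun x => G (fromTorus x) := hGm.comp measurable_fromTorus
    have hcell : (fun z => G (fromTorus (toTorus z))) =ᵐ[volume.restrict cell] G := by
      filter_upwards [ae_restrict_mem measurableSet_cell] with z hz
      rw [fromTorus_toTorus hz]
    have hGL : MemLp G 2 (volume.restrict cell) := by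
      refine (memLp_cell u).of_le hGm.aestronglyMeasurable (ae_of_all _ fun z => ?_)
      rw [hG, norm_mul, RCLike.norm_conj, norm_planeWave, one_mul]
      exact PiLp.norm_apply_le (fn u z) c
    have hmem : MemLp (fun x => G (fromTorus x)) 2 torusMeasure := by
      have h1 : MemLp (fun x => G (fromTorus x)) 2 ((volume.restrict cell).map toTorus) :=
        (memLp_map_measure_iff hGt.aestronglyMeasurable measurable_toTorus.aemeasurable).2
          ((memLp_congr_ae hcell).2 hGL)
      rw [map_toTorus] at h1
      refine h1.of_measure_le_smul (c := (volume cell)⁻¹)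
        (ENNReal.inv_ne_top.2 volume_cell_ne_zero_and_top.1) ?_
      rw [smul_smul, ENNReal.inv_mul_cancel volume_cell_ne_zero_and_top.1
        volume_cell_ne_zero_and_top.2, one_smul]
    have hzero := ae_eq_zero_of_fourier hmem fun n => by
      have h1 := setIntegral_cell_comp_toTorus
        (f := fun x => conj (UnitAddTorus.mFourier n x) * G (fromTorus x))
        (by
          refine AEStronglyMeasurable.mul ?_ hGt.aestronglyMeasurable
          exact Continuous.aestronglyMeasurable (by fun_prop))
      have h2 := h (c, n)
      rw [inner_mode, mul_eq_zero, or_iff_right hA] at h2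
      have h3 : ∫ z in cell, conj (UnitAddTorus.mFourier n (toTorus z)) *
          G (fromTorus (toTorus z)) = 0 := by
        rw [← h2]
        refine integral_congr_ae ?_
        filter_upwards [hcell] with z hz
        rw [hz, hG, planeWave_freq, map_mul]
        ring
      rw [h3] at h1
      exact (mul_eq_zero.1 h1.symm).resolve_left (ofReal_ne_zero.2 cellArea_pos.ne')
    have h4 : ∀ᵐ x ∂((volume.restrict cell).map toTorus), G (fromTorus x) = 0 := by
      rw [map_toTorus]
      exact Measure.ae_smul_measure hzero _
    filter_upwards [ae_of_ae_map measurable_toTorus.aemeasurable h4, hcell] with z h5 h6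
    rw [h6] at h5
    exact (mul_eq_zero.1 h5).resolve_left (by simpa using planeWave_ne_zero _ z)
  apply toCell_injective
  rw [map_zero, Lp.eq_zero_iff_ae_eq_zero]
  refine (memLp_cell u).coeFn_toLp.trans ?_
  filter_upwards [hc 0, hc 1] with z h0 h1
  ext c
  fin_cases c
  · exact h0
  · exact h1

/-- The Fourier basis of `L²_0`. -/
def modeBasis : HilbertBasis (Fin 2 × (Fin 2 → ℤ)) ℂ L2zero :=
  HilbertBasis.mkOfOrthogonalEqBot orthonormal_mode <| by
    rw [Submodule.eq_bot_iff]
    intro u hu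
    refine eq_zero_of_inner_mode fun i => ?_
    exact (Submodule.mem_orthogonal _ _).1 hu _ (Submodule.subset_span ⟨i, rfl⟩)

lemma modeBasis_apply (i : Fin 2 × (Fin 2 → ℤ)) : modeBasis i = mode i := by
  rw [modeBasis, HilbertBasis.coe_mkOfOrthogonalEqBot]

/-! ### The symbol of `2 D_{\bar z}` -/

/-- The eigenvalue of `2 D_{\bar z}` on `planeWave a`. -/
def dbarSymbol (a : Fin 2 → ℝ) : ℂ :=
  2 * Real.pi * ((a 1 : ℂ) + I * ((2 * a 0 + a 1) / √3 : ℝ))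

lemma fderiv_planeWave (a : Fin 2 → ℝ) (z v : ℂ) : fderiv ℝ (planeWave a) z v =
    planeWave a z * ((2 * Real.pi * (a 0 * latticeCoord v 0 + a 1 * latticeCoord v 1) : ℝ) * I) := by
  have h0 (i : Fin 2) : HasFDerivAt (fun z => latticeCoord z i)
      ((ContinuousLinearMap.proj i : (Fin 2 → ℝ) →L[ℝ] ℝ) ∘L
        (latticeCoord : ℂ →L[ℝ] (Fin 2 → ℝ))) z :=
    ((ContinuousLinearMap.proj i : (Fin 2 → ℝ) →L[ℝ] ℝ) ∘L
      (latticeCoord : ℂ →L[ℝ] (Fin 2 → ℝ))).hasFDerivAt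
  have h1 := (((h0 0).const_mul (a 0)).add ((h0 1).const_mul (a 1))).const_mul (2 * Real.pi)
  have h2 := ((ofRealCLM.hasFDerivAt.comp z h1).mul_const I).cexp
  rw [show fderiv ℝ (planeWave a) z = _ from h2.fderiv]
  simp [planeWave]
  ring

lemma latticeCoord_one : latticeCoord 1 = ![0, 1] := by
  simpa using latticeCoord_apply_combination 0 1

lemma latticeCoord_I : latticeCoord I = ![2 / √3, 1 / √3] := by
  have h3 : √3 ≠ 0 := by positivity
  have h := latticeCoord_apply_combination (2 / √3) (1 / √3)
  rw [← h]
  congr 1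
  apply Complex.ext
  · simp only [I_re, add_re, re_ofReal_mul, omega_re, ofReal_re]
    field_simp
    norm_num
  · simp only [I_im, add_im, im_ofReal_mul, omega_im, ofReal_im]
    field_simp
    norm_num

lemma twoDbar_planeWave (a : Fin 2 → ℝ) (z : ℂ) :
    twoDbar (planeWave a) z = dbarSymbol a * planeWave a z := by
  rw [twoDbar, fderiv_planeWave, fderiv_planeWave, latticeCoord_one, latticeCoord_I, dbarSymbol]
  simp only [Matrix.cons_val_zero, Matrix.cons_val_one]
  push_cast
  linear_combination (-2 * Real.pi * planeWave a z * (a 1 + I * ((2 * a 0 + a 1) / (√3 : ℝ)))) * I_sq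

/-- The symbol satisfies `|dbarSymbol a|² = (16 π² / 3) (a₀² + a₀ a₁ + a₁²)`. The weaker lower bound
by a product makes the sums over the two frequency coordinates separate. -/
lemma abs_mul_abs_le_norm_dbarSymbol_sq (a : Fin 2 → ℝ) :
    |a 0| * |a 1| ≤ ‖dbarSymbol a‖ ^ 2 := by
  have h3 : √3 ^ 2 = 3 := Real.sq_sqrt (by norm_num)
  have h : ‖dbarSymbol a‖ ^ 2 =
      (2 * Real.pi) ^ 2 * (a 1 ^ 2 + (2 * a 0 + a 1) ^ 2 / 3) := by
    rw [dbarSymbol, norm_mul, mul_pow, mul_comm I, ← normSq_eq_norm_sq ((a 1 : ℂ) + _),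
      normSq_add_mul_I, div_pow, h3]
    simp [abs_of_pos Real.pi_pos]
  have hpi : 1 ≤ (2 * Real.pi) ^ 2 := by nlinarith [Real.pi_gt_three]
  have h4 : |a 0| * |a 1| ≤ a 1 ^ 2 + (2 * a 0 + a 1) ^ 2 / 3 := by
    rw [← abs_mul, abs_le]
    constructor <;> nlinarith [sq_nonneg (a 0 + a 1), sq_nonneg (a 0 - a 1)]
  rw [h]
  nlinarith [mul_nonneg (abs_nonneg (a 0)) (abs_nonneg (a 1))]

/-- The coordinates of a frequency lie in `ℤ ± 1/3`, so they do not vanish: `±K` is not in the dual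
lattice. -/
lemma abs_freq_ge (c : Fin 2) (n : Fin 2 → ℤ) (j : Fin 2) : 1 / 3 ≤ |freq c n j| := by
  have h : ∃ d : ℤ, freq c n j = (d : ℝ) / 3 ∧ d ≠ 0 := by
    fin_cases c
    · refine ⟨3 * n j + 1, ?_, by lia⟩
      simp only [freq, freqShift, Fin.zero_eta, Matrix.cons_val_zero]
      push_cast
      ring
    · refine ⟨3 * n j - 1, ?_, by lia⟩
      simp only [freq, freqShift, Fin.mk_one, Matrix.cons_val_one]
      push_cast
      ring
  obtain ⟨d, hd, hd0⟩ := h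
  have h1 : (1 : ℝ) ≤ |(d : ℝ)| := by exact_mod_cast Int.one_le_abs hd0
  rw [hd, abs_div, abs_of_pos (by norm_num : (0 : ℝ) < 3)]
  linarith

lemma norm_dbarSymbol_freq_ge (c : Fin 2) (n : Fin 2 → ℤ) : 1 / 3 ≤ ‖dbarSymbol (freq c n)‖ := by
  have h := abs_mul_abs_le_norm_dbarSymbol_sq (freq c n)
  have h1 : 1 / 3 * (1 / 3) ≤ |freq c n 0| * |freq c n 1| := by
    gcongr <;> exact abs_freq_ge _ _ _
  nlinarith [norm_nonneg (dbarSymbol (freq c n))]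

lemma dbarSymbol_freq_ne_zero (c : Fin 2) (n : Fin 2 → ℤ) : dbarSymbol (freq c n) ≠ 0 := by
  have h := norm_dbarSymbol_freq_ge c n
  exact norm_pos_iff.1 (by linarith)

/-- The eigenvalues of the inverse of `2 D_{\bar z}`. -/
def resolventEigenvalue (i : Fin 2 × (Fin 2 → ℤ)) : ℂ := (dbarSymbol (freq i.1 i.2))⁻¹

lemma norm_resolventEigenvalue_le (i : Fin 2 × (Fin 2 → ℤ)) : ‖resolventEigenvalue i‖ ≤ 3 := by
  rw [resolventEigenvalue, norm_inv]
  exact inv_le_of_inv_le₀ (by norm_num) (by simpa using norm_dbarSymbol_freq_ge i.1 i.2)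

lemma summable_resolventEigenvalue : Summable fun i => ‖resolventEigenvalue i‖ ^ 4 := by
  have h1 (c : Fin 2) : Summable fun n : ℤ => 1 / |(n : ℝ) + freqShift c| ^ (2 : ℝ) :=
    (Real.summable_one_div_int_add_rpow _ _).2 (by norm_num)
  have h2 (c : Fin 2) : Summable fun n : Fin 2 → ℤ =>
      1 / |(n 0 : ℝ) + freqShift c| ^ (2 : ℝ) * (1 / |(n 1 : ℝ) + freqShift c| ^ (2 : ℝ)) :=
    (finTwoArrowEquiv ℤ).summable_iff.2 <| (h1 c).mul_of_nonneg (h1 c)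
      (fun n => by positivity) (fun n => by positivity)
  have h3 : Summable fun i : Fin 2 × (Fin 2 → ℤ) => 1 / |(i.2 0 : ℝ) + freqShift i.1| ^ (2 : ℝ) *
      (1 / |(i.2 1 : ℝ) + freqShift i.1| ^ (2 : ℝ)) :=
    (summable_prod_of_nonneg fun i => by positivity).2 ⟨h2, (hasSum_fintype _).summable⟩
  refine h3.of_nonneg_of_le (fun i => by positivity) fun i => ?_
  have h4 := abs_mul_abs_le_norm_dbarSymbol_sq (freq i.1 i.2)
  have h5 := abs_freq_ge i.1 i.2
  have h50 := h5 0
  have h51 := h5 1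
  rw [resolventEigenvalue, norm_inv, inv_pow, Real.rpow_two, Real.rpow_two, one_div_mul_one_div,
    one_div, ← mul_pow]
  refine inv_anti₀ (by
    change 0 < (|freq i.1 i.2 0| * |freq i.1 i.2 1|) ^ 2
    have : 0 < |freq i.1 i.2 0| * |freq i.1 i.2 1| := mul_pos (by linarith) (by linarith)
    positivity) ?_
  calc (|freq i.1 i.2 0| * |freq i.1 i.2 1|) ^ 2 ≤ (‖dbarSymbol (freq i.1 i.2)‖ ^ 2) ^ 2 := by
        gcongr
    _ = _ := by ring

/-! ### Diagonal operators -/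

section Diagonal

variable {κ H : Type*} [NormedAddCommGroup H] [InnerProductSpace ℂ H]

/-- The diagonal operator with bounded eigenvalues `l` in a Hilbert basis. -/
def diagonalOp (e : HilbertBasis κ ℂ H) (l : κ → ℂ) {C : ℝ} (hC : 0 ≤ C) (hl : ∀ i, ‖l i‖ ≤ C) :
    H →L[ℂ] H :=
  (e.repr.symm.toContinuousLinearEquiv : _ →L[ℂ] H) ∘L
    lp.mapCLM 2 (fun i => l i • ContinuousLinearMap.id ℂ ℂ) hC
      (fun i => by
        rw [norm_smul]
        exact (mul_le_of_le_one_right (norm_nonneg _) ContinuousLinearMap.norm_id_le).trans (hl i))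
    ∘L (e.repr.toContinuousLinearEquiv : H →L[ℂ] _)

variable (e : HilbertBasis κ ℂ H) (l : κ → ℂ) {C : ℝ} (hC : 0 ≤ C) (hl : ∀ i, ‖l i‖ ≤ C)

lemma inner_diagonalOp (i : κ) (x : H) :
    inner ℂ (e i) (diagonalOp e l hC hl x) = l i * inner ℂ (e i) x := by
  rw [← e.repr_apply_apply, ← e.repr_apply_apply]
  simp [diagonalOp]

lemma ext_inner_basis {e : HilbertBasis κ ℂ H} {x y : H}
    (h : ∀ i, inner ℂ (e i) x = inner ℂ (e i) y) : x = y := by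
  apply e.repr.injective
  ext i
  rw [e.repr_apply_apply, e.repr_apply_apply, h]

lemma inner_basis [DecidableEq κ] (e : HilbertBasis κ ℂ H) (i j : κ) :
    inner ℂ (e i) (e j) = if i = j then (1 : ℂ) else 0 :=
  orthonormal_iff_ite.1 e.orthonormal i j

lemma diagonalOp_basis (i : κ) : diagonalOp e l hC hl (e i) = l i • e i := by
  classical
  refine ext_inner_basis (e := e) fun j => ?_
  rw [inner_diagonalOp, inner_smul_right, inner_basis]
  split_ifs with h
  · rw [h]
  · simp

lemma adjoint_diagonalOp_basis [CompleteSpace H] (i : κ) :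
    ContinuousLinearMap.adjoint (diagonalOp e l hC hl) (e i) = conj (l i) • e i := by
  classical
  refine ext_inner_basis (e := e) fun j => ?_
  rw [ContinuousLinearMap.adjoint_inner_right, diagonalOp_basis, inner_smul_left, inner_smul_right,
    inner_basis]
  split_ifs with h
  · rw [h]
  · simp

lemma clm_ext_basis {F : Type*} [NormedAddCommGroup F] [NormedSpace ℂ F] {e : HilbertBasis κ ℂ H}
    {f g : H →L[ℂ] F} (h : ∀ i, f (e i) = g (e i)) : f = g := by
  refine ContinuousLinearMap.ext_on (s := Set.range e) ?_ ?_
  · rw [Submodule.dense_iff_topologicalClosure_eq_top]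
    exact e.dense_span
  · rintro _ ⟨i, rfl⟩
    exact h i

end Diagonal

/-- The inverse of `2 D_{\bar z}` on `L²_0`, as a Fourier multiplier. -/
def dbarInverse : L2zero →L[ℂ] L2zero :=
  diagonalOp modeBasis resolventEigenvalue (by norm_num) norm_resolventEigenvalue_le

/-! ### Testing against compactly supported functions -/

lemma integrableOn_fn (u : L2zero) {S : Set ℂ} (hS : IsCompact S) :
    IntegrableOn (fn u) S := by
  have : IsFiniteMeasure (volume.restrict S) :=
    ⟨by rw [Measure.restrict_apply_univ]; exact hS.measure_lt_top⟩
  exact (u.2.1 S hS).integrable one_le_two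

lemma integrable_smul_fn {φ : ℂ → ℂ} (hφ : Continuous φ) (hs : HasCompactSupport φ) (u : L2zero) :
    Integrable fun z => φ z • fn u z := by
  obtain ⟨B, hB⟩ := hφ.bounded_above_of_compact_support hs
  rw [← integrableOn_iff_integrable_of_support_subset (s := tsupport φ)]
  · exact (integrableOn_fn u hs).bdd_smul B hφ.aestronglyMeasurable (ae_of_all _ hB)
  · intro z hz
    refine subset_tsupport φ fun h => hz ?_
    simp only [h, zero_smul]

lemma exists_norm_integral_smul_fn_le {φ : ℂ → ℂ} (hφ : Continuous φ) (hs : HasCompactSupport φ) :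
    ∃ C : ℝ, ∀ u : L2zero, ‖∫ z, φ z • fn u z‖ ≤ C * ‖u‖ := by
  obtain ⟨B, hB⟩ := hφ.bounded_above_of_compact_support hs
  obtain ⟨N, hN⟩ := exists_lintegral_le_cell (S := tsupport φ) hs
  set D : ℝ≥0∞ := ENNReal.ofReal B * (N * volume cell ^ (1 / 2 : ℝ)) with hD
  have hD' : D ≠ ⊤ := by
    refine ENNReal.mul_ne_top ENNReal.ofReal_ne_top (ENNReal.mul_ne_top (ENNReal.natCast_ne_top N) ?_)
    exact ENNReal.rpow_ne_top_of_nonneg (by norm_num) volume_cell_ne_zero_and_top.2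
  refine ⟨D.toReal, fun u => ?_⟩
  have hu := norm_eq_eLpNorm u
  have h1 : ‖∫ z, φ z • fn u z‖ₑ ≤ D * ENNReal.ofReal ‖u‖ := by
    calc ‖∫ z, φ z • fn u z‖ₑ ≤ ∫⁻ z, ‖φ z • fn u z‖ₑ := enorm_integral_le_lintegral_enorm _
      _ = ∫⁻ z in tsupport φ, ‖φ z • fn u z‖ₑ := by
          refine (setLIntegral_eq_of_support_subset fun z hz => subset_tsupport φ fun h => hz ?_).symm
          simp only [h, zero_smul, enorm_zero]
      _ ≤ ∫⁻ z in tsupport φ, ENNReal.ofReal B * ‖fn u z‖ₑ := by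
          refine lintegral_mono fun z => ?_
          rw [enorm_smul]
          gcongr
          rw [← ofReal_norm]
          exact ENNReal.ofReal_le_ofReal (hB z)
      _ = ENNReal.ofReal B * ∫⁻ z in tsupport φ, ‖fn u z‖ₑ :=
          lintegral_const_mul' _ _ ENNReal.ofReal_ne_top
      _ ≤ ENNReal.ofReal B * (N * ∫⁻ z in cell, ‖fn u z‖ₑ) := by
          gcongr
          refine hN _ fun γ hγ => ?_
          filter_upwards [u.2.2 γ hγ] with z hz
          rw [fn, ← hz, ← ofReal_norm, ← ofReal_norm, norm_rho]
      _ ≤ ENNReal.ofReal B * (N * (ENNReal.ofReal ‖u‖ * volume cell ^ (1 / 2 : ℝ))) := by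
          gcongr
          rw [hu, ← eLpNorm_one_eq_lintegral_enorm]
          refine (eLpNorm_le_eLpNorm_mul_rpow_measure_univ one_le_two
            (memLp_cell u).aestronglyMeasurable).trans_eq ?_
          rw [Measure.restrict_apply_univ]
          norm_num
      _ = D * ENNReal.ofReal ‖u‖ := by rw [hD]; ring
  rw [← toReal_enorm]
  refine (ENNReal.toReal_mono (ENNReal.mul_ne_top hD' ENNReal.ofReal_ne_top) h1).trans_eq ?_
  rw [ENNReal.toReal_mul, ENNReal.toReal_ofReal (norm_nonneg _)]

/-- The functional `u ↦ ∫ φ u` is continuous on `L²_0`. -/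
def testFunctional {φ : ℂ → ℂ} (hφ : Continuous φ) (hs : HasCompactSupport φ) :
    L2zero →L[ℂ] E2 :=
  LinearMap.mkContinuousOfExistsBound
    { toFun := fun u => ∫ z, φ z • fn u z
      map_add' := fun u v => by
        rw [← integral_add (integrable_smul_fn hφ hs u) (integrable_smul_fn hφ hs v)]
        refine integral_congr_ae ?_
        filter_upwards [fn_add u v] with z hz
        rw [hz, smul_add]
      map_smul' := fun c u => by
        rw [RingHom.id_apply, ← integral_smul]
        refine integral_congr_ae ?_
        filter_upwards [fn_smul c u] with z hz
        rw [hz, smul_comm] }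
    (exists_norm_integral_smul_fn_le hφ hs)

lemma testFunctional_apply {φ : ℂ → ℂ} (hφ : Continuous φ) (hs : HasCompactSupport φ) (u : L2zero) :
    testFunctional hφ hs u = ∫ z, φ z • fn u z := rfl

lemma testFunctional_mode {φ : ℂ → ℂ} (hφ : Continuous φ) (hs : HasCompactSupport φ)
    (i : Fin 2 × (Fin 2 → ℤ)) : testFunctional hφ hs (mode i) =
      ((√cellArea : ℝ) : ℂ)⁻¹ • (∫ z, φ z * planeWave (freq i.1 i.2) z) •
        EuclideanSpace.single i.1 (1 : ℂ) := by
  rw [testFunctional_apply, ← integral_smul_const, ← integral_smul]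
  refine integral_congr_ae ?_
  filter_upwards [fn_mode i] with z hz
  rw [hz, modeFun, smul_comm, smul_smul (φ z)]

lemma continuous_twoDbar {φ : ℂ → ℂ} (hφ : ContDiff ℝ ∞ φ) : Continuous (twoDbar φ) := by
  have h := hφ.continuous_fderiv (by simp)
  have h1 (v : ℂ) : Continuous fun z => fderiv ℝ φ z v := h.clm_apply continuous_const
  exact continuous_const.mul ((h1 1).add (continuous_const.mul (h1 I)))

lemma hasCompactSupport_twoDbar {φ : ℂ → ℂ} (hs : HasCompactSupport φ) :
    HasCompactSupport (twoDbar φ) := by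
  refine (hs.fderiv ℝ).mono fun z hz h => hz ?_
  rw [twoDbar, h]
  simp

/-- Integration by parts against a plane wave. -/
lemma integral_twoDbar_mul_planeWave {φ : ℂ → ℂ} (hφ : ContDiff ℝ ∞ φ) (hs : HasCompactSupport φ)
    (a : Fin 2 → ℝ) : ∫ z, twoDbar φ z * planeWave a z =
      -(dbarSymbol a * ∫ z, φ z * planeWave a z) := by
  have hint {g : ℂ → ℂ} (hg : Continuous g) (hgs : HasCompactSupport g) : Integrable g :=
    hg.integrable_of_hasCompactSupport hgs
  have hp := contDiff_planeWave a
  have hdφ (v : ℂ) : Continuous fun z => fderiv ℝ φ z v :=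
    (hφ.continuous_fderiv (by simp)).clm_apply continuous_const
  have hdp (v : ℂ) : Continuous fun z => fderiv ℝ (planeWave a) z v :=
    (hp.continuous_fderiv (by simp)).clm_apply continuous_const
  have i1 (v : ℂ) : Integrable fun z => fderiv ℝ φ z v * planeWave a z :=
    hint ((hdφ v).mul hp.continuous) ((hs.fderiv_apply ℝ v).mul_right)
  have i2 (v : ℂ) : Integrable fun z => φ z * fderiv ℝ (planeWave a) z v :=
    hint (hφ.continuous.mul (hdp v)) hs.mul_right
  have i3 : Integrable fun z => φ z * planeWave a z :=
    hint (hφ.continuous.mul hp.continuous) hs.mul_right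
  have hparts (v : ℂ) := integral_mul_fderiv_eq_neg_fderiv_mul_of_integrable (i1 v) (i2 v) i3
    (fun x _ => hφ.differentiable (by simp) x) (fun x _ => hp.differentiable (by simp) x)
  have h1 : ∫ z, twoDbar φ z * planeWave a z = -I * ((∫ z, fderiv ℝ φ z 1 * planeWave a z) +
      I * ∫ z, fderiv ℝ φ z I * planeWave a z) := by
    rw [← integral_const_mul I, ← integral_add (i1 1) ((i1 I).const_mul I), ← integral_const_mul]
    refine integral_congr_ae (ae_of_all _ fun z => ?_)
    simp only [twoDbar]
    ring
  have h2 : ∫ z, φ z * twoDbar (planeWave a) z = -I * ((∫ z, φ z * fderiv ℝ (planeWave a) z 1) +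
      I * ∫ z, φ z * fderiv ℝ (planeWave a) z I) := by
    rw [← integral_const_mul I, ← integral_add (i2 1) ((i2 I).const_mul I), ← integral_const_mul]
    refine integral_congr_ae (ae_of_all _ fun z => ?_)
    simp only [twoDbar]
    ring
  rw [hparts, hparts] at h2
  have h3 : ∫ z, φ z * twoDbar (planeWave a) z = dbarSymbol a * ∫ z, φ z * planeWave a z := by
    rw [← integral_const_mul]
    refine integral_congr_ae (ae_of_all _ fun z => ?_)
    simp only [twoDbar_planeWave]
    ring
  rw [h1, ← h3, h2]
  ring

lemma testFunctional_twoDbar_mode {φ : ℂ → ℂ} (hφ : ContDiff ℝ ∞ φ) (hs : HasCompactSupport φ)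
    (i : Fin 2 × (Fin 2 → ℤ)) :
    testFunctional (continuous_twoDbar hφ) (hasCompactSupport_twoDbar hs) (mode i) =
      -(dbarSymbol (freq i.1 i.2) • testFunctional hφ.continuous hs (mode i)) := by
  rw [testFunctional_mode, testFunctional_mode, integral_twoDbar_mul_planeWave hφ hs, neg_smul,
    smul_neg, smul_comm (dbarSymbol _), mul_smul]

lemma weakDbarEq_dbarInverse (f : L2zero) : WeakDbarEq (dbarInverse f) f := by
  intro φ hφ hs
  have h : testFunctional (continuous_twoDbar hφ) (hasCompactSupport_twoDbar hs) ∘L dbarInverse =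
      -testFunctional hφ.continuous hs := by
    refine clm_ext_basis (e := modeBasis) fun i => ?_
    rw [ContinuousLinearMap.comp_apply, dbarInverse, diagonalOp_basis, map_smul, modeBasis_apply,
      testFunctional_twoDbar_mode hφ hs, resolventEigenvalue, smul_neg,
      inv_smul_smul₀ (dbarSymbol_freq_ne_zero _ _)]
    rfl
  exact DFunLike.congr_fun h f

/-- A test function that is orthogonal to all but one of the plane waves of the component `c`: the
convolution of the indicator function of the cell with a bump function, both modulated by the
conjugate of `planeWave (freq c m)`. The integral of a convolution against a plane wave is a product,
and its factor coming from the cell vanishes for `n ≠ m`. -/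
lemma exists_test_function (c : Fin 2) (m : Fin 2 → ℤ) : ∃ (φ : ℂ → ℂ) (C : ℂ), ContDiff ℝ ∞ φ ∧
    HasCompactSupport φ ∧ C ≠ 0 ∧
    ∀ n, ∫ z, φ z * planeWave (freq c n) z = if m = n then C else 0 := by
  set b : ContDiffBump (0 : ℂ) := ⟨1, 2, one_pos, one_lt_two⟩
  set f : ℂ → ℂ := cell.indicator fun z => conj (planeWave (freq c m) z) with hf
  set g : ℂ → ℂ := fun z => conj (planeWave (freq c m) z) * (b z : ℂ) with hg
  have hgsm : ContDiff ℝ ∞ g :=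
    (conjCLE.contDiff.comp (contDiff_planeWave _)).mul (ofRealCLM.contDiff.comp b.contDiff)
  have hgs : HasCompactSupport g := by
    have : HasCompactSupport fun z => (b z : ℂ) := b.hasCompactSupport.comp_left ofReal_zero
    exact this.mul_left
  have hcont (a : Fin 2 → ℝ) : Continuous fun z => conj (planeWave a z) :=
    continuous_conj.comp (continuous_planeWave a)
  have hfn (n : Fin 2 → ℤ) : (fun z => f z * planeWave (freq c n) z) =
      cell.indicator fun z => conj (planeWave (freq c m) z) * planeWave (freq c n) z := by
    ext z
    by_cases hz : z ∈ cell <;> simp [hf, hz]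
  have hfi (n : Fin 2 → ℤ) : Integrable fun z => f z * planeWave (freq c n) z := by
    rw [hfn, integrable_indicator_iff measurableSet_cell]
    refine Integrable.of_bound ((hcont _).mul (continuous_planeWave _)).aestronglyMeasurable 1
      (ae_of_all _ fun z => ?_)
    rw [norm_mul, RCLike.norm_conj, norm_planeWave, norm_planeWave, one_mul]
  have hfint : Integrable f := by
    rw [hf, integrable_indicator_iff measurableSet_cell]
    refine Integrable.of_bound (hcont _).aestronglyMeasurable 1 (ae_of_all _ fun z => ?_)
    rw [RCLike.norm_conj, norm_planeWave]
  have hfs : HasCompactSupport f := by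
    have hc : IsCompact (latticeCoord.symm '' (Set.Icc 0 1)) :=
      isCompact_Icc.image latticeCoord.symm.continuous
    refine HasCompactSupport.intro hc fun z hz => Set.indicator_of_notMem (fun h => hz ?_) _
    refine ⟨latticeCoord z, ⟨fun i => ((mem_cell_iff z).1 h i).1,
      fun i => ((mem_cell_iff z).1 h i).2.le⟩, latticeCoord.symm_apply_apply z⟩
  set L := ContinuousLinearMap.mul ℝ ℂ
  refine ⟨convolution f g L volume, cellArea * ∫ z, (b z : ℂ), ?_, hfs.convolution L hgs, ?_,
    fun n => ?_⟩
  · exact hgs.contDiff_convolution_right L hfint.locallyIntegrable hgsm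
  · have hb : ∫ z, (b z : ℂ) = ((∫ z, b z : ℝ) : ℂ) := integral_ofReal
    rw [hb, ← ofReal_mul]
    exact ofReal_ne_zero.2 (mul_pos cellArea_pos b.integral_pos).ne'
  · have hconv : (fun z => convolution f g L volume z * planeWave (freq c n) z) =
        convolution (fun z => f z * planeWave (freq c n) z) (fun z => g z * planeWave (freq c n) z)
          L volume := by
      ext z
      rw [convolution_def, convolution_def, ← integral_mul_const]
      refine integral_congr_ae (ae_of_all _ fun t => ?_)
      have h := planeWave_add (freq c n) t (z - t)
      rw [add_sub_cancel] at h
      simp only [L, ContinuousLinearMap.mul_apply', h]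
      ring
    have hgi : Integrable fun z => g z * planeWave (freq c n) z :=
      (hgsm.continuous.mul (continuous_planeWave _)).integrable_of_hasCompactSupport hgs.mul_right
    rw [hconv, integral_convolution L (hfi n) hgi, hfn, integral_indicator measurableSet_cell,
      setIntegral_cell_planeWave, ContinuousLinearMap.mul_apply']
    split_ifs with h
    · subst h
      congr 1
      refine integral_congr_ae (ae_of_all _ fun z => ?_)
      simp only [hg]
      linear_combination (b z : ℂ) * conj_planeWave_mul_self (freq c m) z
    · rw [zero_mul]

/-- Uniqueness: testing the equation with the functions of `exists_test_function` determines each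
Fourier coefficient of `u` from that of `f`. -/
theorem isDbarInverse_dbarInverse : IsDbarInverse dbarInverse := by
  intro u f
  refine ⟨fun huf => ?_, fun h => h ▸ weakDbarEq_dbarInverse f⟩
  refine ext_inner_basis (e := modeBasis) ?_
  rintro ⟨c, m⟩
  obtain ⟨φ, C, hφ, hs, hC, hφm⟩ := exists_test_function c m
  have hA : ((√cellArea : ℝ) : ℂ)⁻¹ ≠ 0 :=
    inv_ne_zero (ofReal_ne_zero.2 (Real.sqrt_pos.2 cellArea_pos).ne')
  set k := dbarSymbol (freq c m) with hk
  -- Both test functionals only see the coefficient of the mode `(c, m)`.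
  have h1 : (EuclideanSpace.proj (𝕜 := ℂ) c) ∘L testFunctional hφ.continuous hs =
      (((√cellArea : ℝ) : ℂ)⁻¹ * C) • innerSL ℂ (modeBasis (c, m)) := by
    classical
    refine clm_ext_basis (e := modeBasis) ?_
    rintro ⟨d, n⟩
    change (testFunctional hφ.continuous hs (modeBasis (d, n))) c = (((√cellArea : ℝ) : ℂ)⁻¹ * C) •
      inner ℂ (modeBasis (c, m)) (modeBasis (d, n))
    rw [inner_basis, modeBasis_apply, testFunctional_mode]
    by_cases hcd : c = d
    · subst hcd
      by_cases hmn : m = n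
      · subst hmn; simp [hφm]
      · simp [hφm, hmn]
    · simp [hcd]
  have h2 : (EuclideanSpace.proj (𝕜 := ℂ) c) ∘L
      testFunctional (continuous_twoDbar hφ) (hasCompactSupport_twoDbar hs) =
      (-(k * (((√cellArea : ℝ) : ℂ)⁻¹ * C))) • innerSL ℂ (modeBasis (c, m)) := by
    classical
    refine clm_ext_basis (e := modeBasis) ?_
    rintro ⟨d, n⟩
    have h3 := DFunLike.congr_fun h1 (modeBasis (d, n))
    change (testFunctional hφ.continuous hs (modeBasis (d, n))) c = (((√cellArea : ℝ) : ℂ)⁻¹ * C) *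
      inner ℂ (modeBasis (c, m)) (modeBasis (d, n)) at h3
    change (testFunctional (continuous_twoDbar hφ) (hasCompactSupport_twoDbar hs)
      (modeBasis (d, n))) c = (-(k * (((√cellArea : ℝ) : ℂ)⁻¹ * C))) *
      inner ℂ (modeBasis (c, m)) (modeBasis (d, n))
    rw [modeBasis_apply (d, n)] at h3 ⊢
    rw [testFunctional_twoDbar_mode hφ hs, PiLp.neg_apply, PiLp.smul_apply, h3, ← modeBasis_apply,
      inner_basis]
    split_ifs with h
    · obtain ⟨rfl, rfl⟩ := Prod.mk.inj h
      simp [hk]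
    · simp
  have h4 : testFunctional (continuous_twoDbar hφ) (hasCompactSupport_twoDbar hs) u =
      -testFunctional hφ.continuous hs f := huf φ hφ hs
  have h5 : (-(k * (((√cellArea : ℝ) : ℂ)⁻¹ * C))) * inner ℂ (modeBasis (c, m)) u =
      -((((√cellArea : ℝ) : ℂ)⁻¹ * C) * inner ℂ (modeBasis (c, m)) f) := by
    have h6 := DFunLike.congr_fun h2 u
    have h7 := DFunLike.congr_fun h1 f
    refine h6.symm.trans ?_
    rw [ContinuousLinearMap.comp_apply, h4, map_neg]
    exact congrArg Neg.neg h7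
  rw [dbarInverse, inner_diagonalOp, resolventEigenvalue]
  have hk0 : k ≠ 0 := dbarSymbol_freq_ne_zero c m
  rw [← hk, eq_inv_mul_iff_mul_eq₀ hk0]
  refine mul_left_cancel₀ (mul_ne_zero hA hC) ?_
  linear_combination -h5

/-! ### The rotation -/

lemma omega_sq : omega ^ 2 = -1 - omega := by
  have h3 : √3 * √3 = 3 := Real.mul_self_sqrt (by norm_num)
  apply Complex.ext
  · simp only [pow_two, mul_re, sub_re, neg_re, one_re, omega_re, omega_im]
    linear_combination (-1 / 4) * h3
  · simp only [pow_two, mul_im, sub_im, neg_im, one_im, omega_re, omega_im]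
    ring

lemma omega_pow_three : omega ^ 3 = 1 := by
  linear_combination (omega - 1) * omega_sq

lemma omega_ne_zero : omega ≠ 0 := exp_ne_zero _

lemma conj_omega : conj omega = omega⁻¹ := by
  rw [Complex.inv_def, normSq_eq_norm_sq, norm_omega]
  simp

lemma omega_mul_mem_lattice {γ : ℂ} (hγ : γ ∈ lattice) : omega * γ ∈ lattice := by
  obtain ⟨a, b, rfl⟩ := hγ
  refine ⟨b - a, -a, ?_⟩
  push_cast
  linear_combination (a : ℂ) * omega_sq

/-- `⟨ω γ - γ, K⟩ ∈ 2π ℤ`. -/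
lemma chi_omega_mul {γ : ℂ} (hγ : γ ∈ lattice) : chi (omega * γ) = chi γ := by
  obtain ⟨a, b, rfl⟩ := hγ
  have h : omega * (a * omega + b) = ((b - a : ℤ) : ℂ) * omega + ((-a : ℤ) : ℂ) := by
    push_cast
    linear_combination (a : ℂ) * omega_sq
  rw [h, chi_eq_exp, chi_eq_exp, exp_eq_exp_iff_exists_int]
  refine ⟨-b, ?_⟩
  push_cast
  ring

lemma measurePreserving_omega_mul : MeasurePreserving (fun z : ℂ => omega * z) volume volume :=
  (rotation ⟨omega, by simp [Submonoid.unitSphere, norm_omega]⟩).measurePreserving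

lemma cell_subset_closedBall : cell ⊆ Metric.closedBall 0 2 := by
  rintro z ⟨s, t, hs, ht, rfl⟩
  rw [mem_closedBall_zero_iff]
  calc ‖(s * omega + t : ℂ)‖ ≤ ‖(s * omega : ℂ)‖ + ‖(t : ℂ)‖ := norm_add_le _ _
    _ = |s| + |t| := by rw [norm_mul, norm_omega, norm_real, norm_real]; simp
    _ ≤ 2 := by rw [abs_of_nonneg hs.1, abs_of_nonneg ht.1]; linarith [hs.2, ht.2]

lemma measurePreserving_omega_mul_ball : MeasurePreserving (fun z : ℂ => omega * z)
    (volume.restrict (Metric.closedBall 0 2)) (volume.restrict (Metric.closedBall 0 2)) := by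
  have h := measurePreserving_omega_mul.restrict_preimage
    (s := Metric.closedBall (0 : ℂ) 2) measurableSet_closedBall
  have h2 : (fun z : ℂ => omega * z) ⁻¹' Metric.closedBall 0 2 = Metric.closedBall 0 2 := by
    ext z
    simp [norm_omega]
  rwa [h2] at h

lemma memLp_rotate (u : L2zero) :
    MemLp (fun z => fn u (omega * z)) 2 (volume.restrict (Metric.closedBall 0 2)) :=
  (u.2.1 _ (isCompact_closedBall 0 2)).comp_measurePreserving measurePreserving_omega_mul_ball

lemma rotate_mem (u : L2zero) :
    (u : ℂ →ₘ[volume] E2).compMeasurePreserving _ measurePreserving_omega_mul ∈ L2zeroSub := by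
  rw [AEEqFun.compMeasurePreserving_eq_mk]
  refine mem_L2zeroSub _ ((memLp_rotate u).mono_measure
    (Measure.restrict_mono cell_subset_closedBall le_rfl)) fun γ hγ => ?_
  filter_upwards [ae_rotate (u.2.2 _ (omega_mul_mem_lattice hγ))] with z hz
  rw [Function.comp_apply, Function.comp_apply, ← hz, mul_add, rho, rho, chi_omega_mul hγ]

/-- The rotated function `u(ω ·)`. -/
def rotateFun (u : L2zero) : L2zero := ⟨_, rotate_mem u⟩

lemma fn_rotateFun (u : L2zero) : ∀ᵐ z, fn (rotateFun u) z = fn u (omega * z) :=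
  AEEqFun.coeFn_compMeasurePreserving (u : ℂ →ₘ[volume] E2) measurePreserving_omega_mul

/-- Rotation `u ↦ u(ω ·)` as a linear map of `L²_0`. -/
def rotateLin : L2zero →ₗ[ℂ] L2zero where
  toFun := rotateFun
  map_add' u v := by
    refine L2zero_ext ?_
    filter_upwards [fn_rotateFun (u + v), fn_rotateFun u, fn_rotateFun v, ae_rotate (fn_add u v),
      fn_add (rotateFun u) (rotateFun v)] with z h1 h2 h3 h4 h5
    rw [h5, h1, h2, h3, h4]
  map_smul' c u := by
    refine L2zero_ext ?_
    filter_upwards [fn_rotateFun (c • u), fn_rotateFun u, ae_rotate (fn_smul c u),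
      fn_smul c (rotateFun u)] with z h1 h2 h4 h5
    rw [RingHom.id_apply, h5, h1, h2, h4]

lemma fn_rotateLin (u : L2zero) : ∀ᵐ z, fn (rotateLin u) z = fn u (omega * z) := fn_rotateFun u

lemma exists_norm_rotateLin_le : ∃ C : ℝ, ∀ u, ‖rotateLin u‖ ≤ C * ‖u‖ := by
  obtain ⟨N, hN⟩ := exists_lintegral_le_cell (isCompact_closedBall (0 : ℂ) 2)
  set D : ℝ≥0∞ := (N : ℝ≥0∞) ^ (1 / 2 : ℝ)
  have hD : D ≠ ⊤ := ENNReal.rpow_ne_top_of_nonneg (by norm_num) (ENNReal.natCast_ne_top N)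
  refine ⟨D.toReal, fun u => ?_⟩
  have h : ENNReal.ofReal ‖rotateLin u‖ ≤ D * ENNReal.ofReal ‖u‖ := by
    calc ENNReal.ofReal ‖rotateLin u‖
        = eLpNorm (fun z => fn u (omega * z)) 2 (volume.restrict cell) := by
          rw [norm_eq_eLpNorm]
          exact eLpNorm_congr_ae (ae_restrict_of_ae (fn_rotateLin u))
      _ ≤ eLpNorm (fun z => fn u (omega * z)) 2 (volume.restrict (Metric.closedBall 0 2)) :=
          eLpNorm_mono_measure _ (Measure.restrict_mono cell_subset_closedBall le_rfl)
      _ = eLpNorm (fn u) 2 (volume.restrict (Metric.closedBall 0 2)) :=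
          eLpNorm_comp_measurePreserving (u.2.1 _ (isCompact_closedBall 0 2)).aestronglyMeasurable
            measurePreserving_omega_mul_ball
      _ ≤ D * eLpNorm (fn u) 2 (volume.restrict cell) := by
          rw [eLpNorm_eq_lintegral_rpow_enorm_toReal two_ne_zero ENNReal.ofNat_ne_top,
            eLpNorm_eq_lintegral_rpow_enorm_toReal two_ne_zero ENNReal.ofNat_ne_top,
            ENNReal.toReal_ofNat, ← ENNReal.mul_rpow_of_nonneg _ _ (by norm_num)]
          gcongr
          refine hN _ fun γ hγ => ?_
          filter_upwards [u.2.2 γ hγ] with z hz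
          rw [fn, ← hz, ← ofReal_norm, ← ofReal_norm, norm_rho]
      _ = D * ENNReal.ofReal ‖u‖ := by rw [norm_eq_eLpNorm]
  have h2 := ENNReal.toReal_mono (ENNReal.mul_ne_top hD ENNReal.ofReal_ne_top) h
  rwa [ENNReal.toReal_mul, ENNReal.toReal_ofReal (norm_nonneg _),
    ENNReal.toReal_ofReal (norm_nonneg _)] at h2

/-- The rotation operator `u ↦ u(ω ·)` on `L²_0`. -/
def rotate : L2zero →L[ℂ] L2zero := rotateLin.mkContinuousOfExistsBound exists_norm_rotateLin_le

lemma fn_rotate (u : L2zero) : ∀ᵐ z, fn (rotate u) z = fn u (omega * z) := fn_rotateLin u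

lemma mem_L2rot_iff {p : ℤ} {u : L2zero} : u ∈ L2rot p ↔ rotate u = conj omega ^ p • u := by
  constructor
  · intro h
    refine L2zero_ext ?_
    filter_upwards [h, fn_rotate u, fn_smul (conj omega ^ p) u] with z h1 h2 h3
    rw [h2, h3, ← h1]
  · intro h
    change ∀ᵐ z, fn u (omega * z) = conj omega ^ p • fn u z
    have h4 := fn_rotate u
    rw [h] at h4
    filter_upwards [h4, fn_smul (conj omega ^ p) u] with z h2 h3
    rw [← h2, h3]

lemma rotate_pow_three : rotate ^ 3 = 1 := by
  ext1 u
  refine L2zero_ext ?_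
  have h := fn_rotate (rotate (rotate u))
  filter_upwards [h, ae_rotate (fn_rotate (rotate u)), ae_rotate (ae_rotate (fn_rotate u))]
    with z h1 h2 h3
  change fn (rotate (rotate (rotate u))) z = fn u z
  rw [h1, h2, h3]
  congr 1
  linear_combination z * omega_pow_three

/-- The permutation of the Fourier modes induced by the rotation: frequencies `(a₀, a₁)` go to
`(-a₀ - a₁, a₀)`. The integers `±1` absorb the offsets `±1/3` of the frequencies. -/
def rotateIndex (i : Fin 2 × (Fin 2 → ℤ)) : Fin 2 × (Fin 2 → ℤ) :=
  (i.1, ![-i.2 0 - i.2 1 - ![1, -1] i.1, i.2 0])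

lemma freq_rotateIndex (i : Fin 2 × (Fin 2 → ℤ)) : freq i.1 (rotateIndex i).2 =
    ![-freq i.1 i.2 0 - freq i.1 i.2 1, freq i.1 i.2 0] := by
  obtain ⟨c, n⟩ := i
  ext j
  fin_cases j
  · fin_cases c <;> simp [freq, rotateIndex, freqShift] <;> ring
  · simp [freq, rotateIndex]

lemma latticeCoord_omega_mul (z : ℂ) :
    latticeCoord (omega * z) = ![latticeCoord z 1 - latticeCoord z 0, -latticeCoord z 0] := by
  have hz := latticeCoord.symm_apply_apply z
  rw [latticeCoord_symm_apply] at hz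
  rw [← latticeCoord_apply_combination]
  congr 1
  conv_lhs => rw [← hz]
  push_cast
  linear_combination (latticeCoord z 0 : ℂ) * omega_sq

lemma rotate_mode (i : Fin 2 × (Fin 2 → ℤ)) : rotate (mode i) = mode (rotateIndex i) := by
  refine L2zero_ext ?_
  filter_upwards [fn_rotate (mode i), ae_rotate (fn_mode i), fn_mode (rotateIndex i)]
    with z h1 h2 h3
  rw [h1, h2, h3, modeFun, modeFun, show (rotateIndex i).1 = i.1 from rfl, planeWave, planeWave,
    latticeCoord_omega_mul, freq_rotateIndex]
  congr 4
  simp only [Matrix.cons_val_zero, Matrix.cons_val_one]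
  push_cast
  ring

lemma rotateIndex_pow_three (i : Fin 2 × (Fin 2 → ℤ)) :
    rotateIndex (rotateIndex (rotateIndex i)) = i := by
  obtain ⟨c, n⟩ := i
  refine Prod.ext rfl ?_
  ext j
  fin_cases j <;> simp [rotateIndex] <;> ring

lemma rotateIndex_ne (i : Fin 2 × (Fin 2 → ℤ)) : rotateIndex i ≠ i := by
  obtain ⟨c, n⟩ := i
  intro h
  have h1 := congrFun (congrArg Prod.snd h) 0
  have h2 := congrFun (congrArg Prod.snd h) 1
  fin_cases c <;> simp [rotateIndex] at h1 h2 <;> lia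

/-- The rotation permutes the Fourier basis in cycles of length three, so its adjoint is its square. -/
lemma adjoint_rotate : ContinuousLinearMap.adjoint rotate = rotate ^ 2 := by
  classical
  refine clm_ext_basis (e := modeBasis) fun i => ext_inner_basis (e := modeBasis) fun j => ?_
  rw [ContinuousLinearMap.adjoint_inner_right, pow_two]
  change inner ℂ (rotate (modeBasis j)) (modeBasis i) =
    inner ℂ (modeBasis j) (rotate (rotate (modeBasis i)))
  simp only [modeBasis_apply, rotate_mode]
  simp only [← modeBasis_apply, inner_basis]
  refine if_congr ⟨?_, ?_⟩ rfl rfl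
  · rintro rfl
    rw [rotateIndex_pow_three]
  · rintro rfl
    rw [rotateIndex_pow_three]

lemma dbarSymbol_rotateIndex (i : Fin 2 × (Fin 2 → ℤ)) :
    dbarSymbol (freq i.1 (rotateIndex i).2) = omega⁻¹ * dbarSymbol (freq i.1 i.2) := by
  have h3 : ((√3 : ℝ) : ℂ) * ((√3 : ℝ) : ℂ) = 3 := by
    rw [← ofReal_mul, Real.mul_self_sqrt (by norm_num)]
    norm_num
  have hdiv (x : ℂ) : x / ((√3 : ℝ) : ℂ) = x * ((√3 : ℝ) : ℂ) / 3 := by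
    have h30 : ((√3 : ℝ) : ℂ) ≠ 0 := ofReal_ne_zero.2 (by positivity)
    rw [div_eq_iff h30]
    linear_combination -(x / 3) * h3
  have ho : omega⁻¹ = -1 / 2 - ((√3 : ℝ) : ℂ) / 2 * I := by
    rw [← conj_omega]
    apply Complex.ext <;> simp [omega_re, omega_im]
  rw [freq_rotateIndex, ho, dbarSymbol, dbarSymbol]
  simp only [Matrix.cons_val_zero, Matrix.cons_val_one]
  push_cast
  rw [hdiv, hdiv]
  set p : ℂ := (freq i.1 i.2 0 : ℂ)
  set q : ℂ := (freq i.1 i.2 1 : ℂ)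
  linear_combination (2 * Real.pi * (2 * p + q) / 6 * I ^ 2) * h3 + Real.pi * (2 * p + q) * I_sq

/-- Equivalently, `2 D_{\bar z}` of `u(ω ·)` is `\bar ω (2 D_{\bar z} u)(ω ·)`. -/
lemma dbarInverse_mul_rotate : dbarInverse * rotate = omega • (rotate * dbarInverse) := by
  refine clm_ext_basis (e := modeBasis) fun i => ?_
  change dbarInverse (rotate (modeBasis i)) = omega • rotate (dbarInverse (modeBasis i))
  rw [dbarInverse, diagonalOp_basis, map_smul, modeBasis_apply, rotate_mode, ← modeBasis_apply,
    diagonalOp_basis, smul_smul, resolventEigenvalue, resolventEigenvalue,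
    show (rotateIndex i).1 = i.1 from rfl, dbarSymbol_rotateIndex, mul_inv, inv_inv]

section Potential

variable {Up Um : ℂ → ℂ} (hU : IsPotential Up Um)

lemma fn_mulV (u : L2zero) : ∀ᵐ z, fn (mulV hU u) z = Vmat Up Um z (fn u z) := mulVfun_ae hU u

lemma rotate_mul_mulV : rotate * mulV hU = omega • (mulV hU * rotate) := by
  ext1 u
  refine L2zero_ext ?_
  filter_upwards [fn_rotate (mulV hU u), ae_rotate (fn_mulV hU u), fn_mulV hU (rotate u),
    fn_rotate u, fn_smul omega (mulV hU (rotate u)), hU.rotation_plus, hU.rotation_minus]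
    with z h1 h2 h3 h4 h5 h6 h7
  change fn (rotate (mulV hU u)) z = fn (omega • mulV hU (rotate u)) z
  rw [h1, h2, h5, h3, h4]
  ext c
  fin_cases c
  · simp [Vmat, h6, mul_assoc]
  · simp [Vmat, h7, mul_assoc]

end Potential

/-- The orthogonal projection `(1/3) ∑ⱼ ω^(jp) Wʲ` onto `L²_{0,p}`, where `W` is the rotation. -/
def rotProj (p : ℤ) : L2zero →L[ℂ] L2zero :=
  (1 / 3 : ℂ) • (1 + omega ^ p • rotate + (omega ^ p) ^ 2 • rotate ^ 2)

lemma omega_zpow_pow_three (p : ℤ) : (omega ^ p) ^ 3 = 1 := by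
  rw [← zpow_natCast, ← zpow_mul, mul_comm, zpow_mul, zpow_natCast, omega_pow_three, one_zpow]

lemma omega_zpow_neg (p : ℤ) : omega ^ (-p) = (omega ^ p) ^ 2 := by
  rw [zpow_neg]
  exact inv_eq_of_mul_eq_one_right (by linear_combination omega_zpow_pow_three p)

lemma conj_omega_zpow (p : ℤ) : conj (omega ^ p) = (omega ^ p) ^ 2 := by
  rw [map_zpow₀, conj_omega, inv_zpow', omega_zpow_neg]

lemma conj_omega_zpow' (p : ℤ) : conj omega ^ p = (omega ^ p) ^ 2 := by
  rw [← map_zpow₀, conj_omega_zpow]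

lemma adjoint_rotProj (p : ℤ) : ContinuousLinearMap.adjoint (rotProj p) = rotProj p := by
  have h1 : ContinuousLinearMap.adjoint (1 : L2zero →L[ℂ] L2zero) = 1 := star_one _
  have h2 : ContinuousLinearMap.adjoint (rotate ^ 2) = rotate := by
    rw [← adjoint_rotate, ContinuousLinearMap.adjoint_adjoint]
  have h3 : conj (1 / 3 : ℂ) = 1 / 3 := by
    have : conj (3 : ℂ) = 3 := map_ofNat _ 3
    simp [this]
  rw [rotProj]
  simp only [map_smulₛₗ, map_add, h1, h2, adjoint_rotate, h3, map_pow, conj_omega_zpow]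
  congr 1
  have h4 : ((omega ^ p) ^ 2) ^ 2 = omega ^ p := by
    linear_combination omega ^ p * omega_zpow_pow_three p
  rw [h4]
  abel

lemma rotProj_mem (p : ℤ) (u : L2zero) : rotProj p u ∈ L2rot p := by
  rw [mem_L2rot_iff, conj_omega_zpow']
  have h3 : rotate (rotate (rotate u)) = u := DFunLike.congr_fun rotate_pow_three u
  have h := omega_zpow_pow_three p
  change rotate ((1 / 3 : ℂ) • (u + omega ^ p • rotate u + (omega ^ p) ^ 2 • rotate (rotate u))) =
    (omega ^ p) ^ 2 •
      ((1 / 3 : ℂ) • (u + omega ^ p • rotate u + (omega ^ p) ^ 2 • rotate (rotate u)))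
  simp only [map_smul, map_add, h3]
  linear_combination (norm := module) (-(1 / 3 : ℂ)) • h • rotate u - (omega ^ p / 3) • h • rotate (rotate u)

lemma rotProj_apply_of_mem (p : ℤ) (u : L2zero) (hu : u ∈ L2rot p) : rotProj p u = u := by
  rw [mem_L2rot_iff, conj_omega_zpow'] at hu
  have h4 : omega ^ p * (omega ^ p) ^ 2 = 1 := by
    linear_combination omega_zpow_pow_three p
  have h5 : (omega ^ p) ^ 2 * ((omega ^ p) ^ 2 * (omega ^ p) ^ 2) = 1 := by
    linear_combination ((omega ^ p) ^ 3 + 1) * omega_zpow_pow_three p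
  change (1 / 3 : ℂ) • (u + omega ^ p • rotate u + (omega ^ p) ^ 2 • rotate (rotate u)) = u
  rw [hu, map_smul, hu, smul_smul, smul_smul, smul_smul, h4, mul_assoc, h5, one_smul]
  module

/-- The rotation fixes no Fourier mode, so only the identity contributes to the diagonal of the
projection. -/
lemma inner_mode_rotProj (p : ℤ) (i : Fin 2 × (Fin 2 → ℤ)) :
    inner ℂ (modeBasis i) (rotProj p (modeBasis i)) = 1 / 3 := by
  classical
  have h1 : rotateIndex i ≠ i := rotateIndex_ne i
  have h2 : rotateIndex (rotateIndex i) ≠ i := by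
    intro h
    have := rotateIndex_pow_three i
    rw [h] at this
    exact h1 this
  change inner ℂ (modeBasis i) ((1 / 3 : ℂ) • (modeBasis i + omega ^ p • rotate (modeBasis i) +
    (omega ^ p) ^ 2 • rotate (rotate (modeBasis i)))) = 1 / 3
  simp only [modeBasis_apply, rotate_mode]
  simp only [← modeBasis_apply, inner_smul_right, inner_add_right, inner_basis, h1.symm, h2.symm,
    if_true, if_false]
  simp

lemma dbarInverse_mul_rotProj (p : ℤ) :
    dbarInverse * rotProj p = rotProj (p + 1) * dbarInverse := by
  have h2 : dbarInverse * rotate ^ 2 = omega ^ 2 • (rotate ^ 2 * dbarInverse) := by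
    rw [pow_two, ← mul_assoc, dbarInverse_mul_rotate, smul_mul_assoc, mul_assoc,
      dbarInverse_mul_rotate, mul_smul_comm, smul_smul, ← pow_two, mul_assoc]
  rw [rotProj, rotProj, mul_smul_comm, smul_mul_assoc, mul_add, mul_add, add_mul, add_mul,
    mul_smul_comm, mul_smul_comm, smul_mul_assoc, smul_mul_assoc, dbarInverse_mul_rotate, h2,
    smul_smul, smul_smul, zpow_add_one₀ omega_ne_zero, mul_pow, one_mul, mul_one]

lemma mulV_mul_rotProj {Up Um : ℂ → ℂ} (hU : IsPotential Up Um) (p : ℤ) :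
    mulV hU * rotProj p = rotProj (p - 1) * mulV hU := by
  have h1 : mulV hU * rotate = omega⁻¹ • (rotate * mulV hU) := by
    rw [rotate_mul_mulV, inv_smul_smul₀ omega_ne_zero]
  have h2 : mulV hU * rotate ^ 2 = omega⁻¹ ^ 2 • (rotate ^ 2 * mulV hU) := by
    rw [pow_two, ← mul_assoc, h1, smul_mul_assoc, mul_assoc, h1, mul_smul_comm, smul_smul,
      ← pow_two, mul_assoc]
  rw [rotProj, rotProj, mul_smul_comm, smul_mul_assoc, mul_add, mul_add, add_mul, add_mul,
    mul_smul_comm, mul_smul_comm, smul_mul_assoc, smul_mul_assoc, h1, h2,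
    smul_smul, smul_smul, zpow_sub_one₀ omega_ne_zero, mul_pow, one_mul, mul_one]

/-! ### The antiunitary symmetry -/

/-- The quaternionic structure `(v₀, v₁) ↦ (-\bar v₁, \bar v₀)` of `ℂ²`. -/
def quatVec (v : E2) : E2 := !₂[-conj (v 1), conj (v 0)]

lemma continuous_quatVec : Continuous quatVec := by
  unfold quatVec
  fun_prop

lemma quatVec_add (v w : E2) : quatVec (v + w) = quatVec v + quatVec w := by
  ext c
  fin_cases c <;> simp [quatVec]
  ring

lemma quatVec_smul (a : ℂ) (v : E2) : quatVec (a • v) = conj a • quatVec v := by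
  ext c
  fin_cases c <;> simp [quatVec]

lemma quatVec_quatVec (v : E2) : quatVec (quatVec v) = -v := by
  ext c
  fin_cases c <;> simp [quatVec]

lemma norm_quatVec (v : E2) : ‖quatVec v‖ = ‖v‖ := by
  simp [EuclideanSpace.norm_eq, quatVec, add_comm]

/-- The conjugation in `quatVec` is offset by the exchange of the components, on which `ρ` acts by
mutually conjugate characters. -/
lemma rho_quatVec (γ : ℂ) (v : E2) : rho γ (quatVec v) = quatVec (rho γ v) := by
  have h : conj (chi γ)⁻¹ = chi γ := by rw [← conj_chi, conj_conj]
  ext c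
  fin_cases c
  · simp [quatVec, rho, ← conj_chi]
  · simp [quatVec, rho, ← conj_chi]

lemma quat_mem (u : L2zero) :
    (u : ℂ →ₘ[volume] E2).comp quatVec continuous_quatVec ∈ L2zeroSub := by
  rw [AEEqFun.comp_eq_mk]
  refine mem_L2zeroSub _ ?_ fun γ hγ => ?_
  · refine (memLp_cell u).of_le
      (continuous_quatVec.comp_aestronglyMeasurable (memLp_cell u).aestronglyMeasurable)
      (ae_of_all _ fun z => ?_)
    exact (norm_quatVec _).le
  · filter_upwards [u.2.2 γ hγ] with z hz
    rw [Function.comp_apply, Function.comp_apply, rho_quatVec, hz]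

/-- The quaternionic structure applied pointwise. -/
def quatFun (u : L2zero) : L2zero := ⟨_, quat_mem u⟩

lemma fn_quatFun (u : L2zero) : ∀ᵐ z, fn (quatFun u) z = quatVec (fn u z) :=
  AEEqFun.coeFn_comp quatVec continuous_quatVec (u : ℂ →ₘ[volume] E2)

lemma fn_neg (u : L2zero) : ∀ᵐ z, fn (-u) z = -fn u z := by
  have h := fn_smul (-1) u
  rw [neg_one_smul] at h
  filter_upwards [h] with z hz
  rw [hz, neg_one_smul]

lemma quatFun_quatFun (u : L2zero) : quatFun (quatFun u) = -u := by
  refine L2zero_ext ?_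
  filter_upwards [fn_quatFun (quatFun u), fn_quatFun u, fn_neg u] with z h1 h2 h3
  rw [h1, h2, h3, quatVec_quatVec]

lemma quatFun_add (u v : L2zero) : quatFun (u + v) = quatFun u + quatFun v := by
  refine L2zero_ext ?_
  filter_upwards [fn_quatFun (u + v), fn_quatFun u, fn_quatFun v, fn_add u v,
    fn_add (quatFun u) (quatFun v)] with z h1 h2 h3 h4 h5
  rw [h1, h5, h2, h3, h4, quatVec_add]

lemma quatFun_smul (a : ℂ) (u : L2zero) : quatFun (a • u) = conj a • quatFun u := by
  refine L2zero_ext ?_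
  filter_upwards [fn_quatFun (a • u), fn_quatFun u, fn_smul a u, fn_smul (conj a) (quatFun u)]
    with z h1 h2 h3 h4
  rw [h1, h3, h4, h2, quatVec_smul]

lemma norm_quatFun (u : L2zero) : ‖quatFun u‖ = ‖u‖ := by
  have h : ENNReal.ofReal ‖quatFun u‖ = ENNReal.ofReal ‖u‖ := by
    rw [norm_eq_eLpNorm, norm_eq_eLpNorm]
    refine eLpNorm_congr_norm_ae (ae_restrict_of_ae ?_)
    filter_upwards [fn_quatFun u] with z hz
    rw [hz, norm_quatVec]
  exact (ENNReal.ofReal_eq_ofReal_iff (norm_nonneg _) (norm_nonneg _)).1 h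

/-- The antiunitary operator `(u₀, u₁) ↦ (-\bar u₁, \bar u₀)` of `L²_0`. The bilinear form
`⟪J u, v⟫` is the symplectic form `∫ (u₀ v₁ - u₁ v₀)` over the cell. -/
def quat : L2zero ≃ₗᵢ⋆[ℂ] L2zero where
  toFun := quatFun
  map_add' := quatFun_add
  map_smul' := quatFun_smul
  invFun u := -quatFun u
  left_inv u := by
    change -quatFun (quatFun u) = u
    rw [quatFun_quatFun, neg_neg]
  right_inv u := by
    change quatFun (-quatFun u) = u
    rw [← neg_one_smul ℂ (quatFun u), quatFun_smul, quatFun_quatFun]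
    simp
  norm_map' := norm_quatFun

lemma fn_quat (u : L2zero) : ∀ᵐ z, fn (quat u) z = quatVec (fn u z) := fn_quatFun u

lemma quat_rotate (u : L2zero) : quat (rotate u) = rotate (quat u) := by
  refine L2zero_ext ?_
  filter_upwards [fn_quat (rotate u), fn_rotate u, fn_rotate (quat u), ae_rotate (fn_quat u)]
    with z h1 h2 h3 h4
  rw [h1, h2, h3, h4]

lemma transpose_rotate : transpose quat rotate = rotate ^ 2 := by
  ext1 u
  rw [transpose_apply, adjoint_rotate, LinearIsometryEquiv.symm_apply_eq]
  change rotate (rotate (quat u)) = quat (rotate (rotate u))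
  rw [quat_rotate, quat_rotate]

lemma transpose_rotProj (p : ℤ) : transpose quat (rotProj p) = rotProj (-p) := by
  have h1 : transpose quat (rotate ^ 2) = rotate := by
    rw [pow_two, transpose_mul, transpose_rotate, ← pow_add, pow_succ, rotate_pow_three, one_mul]
  have h2 : ((omega ^ p) ^ 2) ^ 2 = omega ^ p := by
    linear_combination omega ^ p * omega_zpow_pow_three p
  rw [rotProj, rotProj, transpose_smul, transpose_add, transpose_add, transpose_smul,
    transpose_smul, transpose_one, transpose_rotate, h1, omega_zpow_neg, h2]
  congr 1
  abel

lemma quat_mode (i : Fin 2 × (Fin 2 → ℤ)) : ∃ s : ℂ,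
    quat (mode i) = s • mode (![1, 0] i.1, -i.2) := by
  obtain ⟨c, n⟩ := i
  have hf : freq (![1, 0] c) (-n) = -freq c n := by
    ext j
    fin_cases c <;> simp [freq, freqShift] <;> ring
  refine ⟨![1, -1] c, L2zero_ext ?_⟩
  filter_upwards [fn_quat (mode (c, n)), fn_mode (c, n), fn_mode (![1, 0] c, -n),
    fn_smul (![1, -1] c) (mode (![1, 0] c, -n))] with z h1 h2 h3 h4
  rw [h1, h2, h4, h3, modeFun, modeFun, quatVec_smul, quatVec_smul]
  simp only
  rw [hf, conj_planeWave]
  ext d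
  fin_cases c <;> fin_cases d <;> simp [quatVec, conj_ofReal]

lemma dbarSymbol_neg (a : Fin 2 → ℝ) : dbarSymbol (-a) = -dbarSymbol a := by
  rw [dbarSymbol, dbarSymbol]
  push_cast [Pi.neg_apply]
  ring

/-- The operator `J` exchanges the modes of frequencies `a` and `-a` in the two components, up to a
sign, and the symbol is odd. -/
lemma transpose_dbarInverse : transpose quat dbarInverse = -dbarInverse := by
  refine clm_ext_basis (e := modeBasis) fun i => ?_
  obtain ⟨s, hs⟩ := quat_mode i
  have hl : resolventEigenvalue (![1, 0] i.1, -i.2) = -resolventEigenvalue i := by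
    have hf : freq (![1, 0] i.1) (-i.2) = -freq i.1 i.2 := by
      obtain ⟨c, n⟩ := i
      ext j
      fin_cases c <;> simp [freq, freqShift] <;> ring
    rw [resolventEigenvalue, hf, dbarSymbol_neg, inv_neg, resolventEigenvalue]
  rw [transpose_apply, LinearIsometryEquiv.symm_apply_eq]
  change _ = quat (-(dbarInverse (modeBasis i)))
  rw [dbarInverse, diagonalOp_basis, modeBasis_apply, hs, map_smul, ← modeBasis_apply,
    adjoint_diagonalOp_basis, map_neg, LinearIsometryEquiv.map_smulₛₗ, hs, hl, smul_comm,
    ← modeBasis_apply, map_neg, neg_smul]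

/-- The matrix `V(z)` has trace zero, hence is skew for the symplectic form of `ℂ²`. -/
lemma transpose_mulV {Up Um : ℂ → ℂ} (hU : IsPotential Up Um) :
    transpose quat (mulV hU) = -mulV hU := by
  ext1 x
  rw [transpose_apply, LinearIsometryEquiv.symm_apply_eq]
  change _ = quat (-(mulV hU x))
  refine ext_inner_right ℂ fun y => ?_
  rw [ContinuousLinearMap.adjoint_inner_left, inner_eq, inner_eq]
  refine integral_congr_ae (ae_restrict_of_ae ?_)
  filter_upwards [fn_quat x, fn_mulV hU y, fn_quat (-(mulV hU x)), fn_neg (mulV hU x),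
    fn_mulV hU x] with z h1 h2 h3 h4 h5
  change inner ℂ (fn (quat x) z) (fn (mulV hU y) z) =
    inner ℂ (fn (quat (-(mulV hU x))) z) (fn y z)
  rw [h1, h2, h3, h4, h5]
  simp only [PiLp.inner_apply, Fin.sum_univ_two, quatVec, Vmat, RCLike.inner_apply]
  simp
  ring

end ChiralTBG

end

theorem proposition2p2 (Up Um : ℂ → ℂ) (hU : ChiralTBG.IsPotential Up Um) :
    ∃ R : ChiralTBG.L2zero →L[ℂ] ChiralTBG.L2zero, ChiralTBG.IsDbarInverse R ∧
    ∃ hinv : ∀ p : ℤ, ∀ u ∈ ChiralTBG.L2rot p, (R ∘L ChiralTBG.mulV hU) u ∈ ChiralTBG.L2rot p,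
    ∀ p : ℤ,
      spectrum ℂ ((R ∘L ChiralTBG.mulV hU).restrict (hinv p)) =
        spectrum ℂ ((R ∘L ChiralTBG.mulV hU).restrict (hinv (-p + 1))) ∧
      ∀ m : ℕ, 2 ≤ m → ∃ τ : ℂ,
        ChiralTBG.HasTrace (((R ∘L ChiralTBG.mulV hU).restrict (hinv p)) ^ (2 * m)) τ ∧
        ChiralTBG.HasTrace (((R ∘L ChiralTBG.mulV hU).restrict (hinv (-p + 1))) ^ (2 * m)) τ := by
  refine ⟨ChiralTBG.dbarInverse, ChiralTBG.isDbarInverse_dbarInverse, ?_⟩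
  exact ChiralTBG.spectrum_and_trace_symmetry ChiralTBG.quat ChiralTBG.modeBasis
    ChiralTBG.adjoint_rotProj ChiralTBG.rotProj_mem ChiralTBG.rotProj_apply_of_mem
    (ChiralTBG.mulV_mul_rotProj hU) ChiralTBG.dbarInverse_mul_rotProj
    (ChiralTBG.transpose_mulV hU) ChiralTBG.transpose_dbarInverse ChiralTBG.transpose_rotProj
    (ChiralTBG.diagonalOp_basis _ _ _ _) (ChiralTBG.adjoint_diagonalOp_basis _ _ _ _)
    ChiralTBG.summable_resolventEigenvalue (c := 1 / 3) (by norm_num)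
    fun p i => by rw [ChiralTBG.inner_mode_rotProj]; norm_num
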